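/- Work over a universe $V$ satisfying $\mathrm{ZF}^-$ ($\mathrm{ZF}$ without the Axiom of Regularity); formally, let $(V,\in)$ be any model of $\mathrm{ZF}^-$, and let "class" mean first-order definable over $(V,\in)$ with parameters. Let $M_0$ be a class and $E_0\subseteq M_0\times M_0$ a class relation such that (i) for every $v\in M_0$, $\{u : u\,E_0\,v\}$ is a set; (ii) $x\notin\mathrm{tc}(y)$ for all $x,y\in M_0$, where $\mathrm{tc}(y)$ is the least transitive set including $y$; (iii) $(M_0,E_0)\models$ Empty Set; (iv) $(M_0,E_0)\models$ Extensionality. For a class $A$ with a relation $R\subseteq A\times A$, let $\mathcal S(A)$ consist of all nonempty sets $y\subseteq A$ which are not represented in $(A,R)$, i.e. for which there is no $v\in A$ with $y=\{u: u\,R\,v\}$. Define by recursion on the ordinals $\alpha$ $$M_{\alpha+1}=M_\alpha\cup\mathcal S(M_\alpha),\qquad E_{\alpha+1}=E_\alpha\cup\bigl(\in\cap\,(M_\alpha\times\mathcal S(M_\alpha))\bigr),$$ where $\mathcal S(M_\alpha)$ is taken with respect to $(M_\alpha,E_\alpha)$, and $M_\alpha=\bigcup_{\beta<\alpha}M_\beta$,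 $E_\alpha=\bigcup_{\beta<\alpha}E_\beta$ for limit $\alpha$. Put $M=\bigcup_{\alpha\in On}M_\alpha$ and $E=\bigcup_{\alpha\in On}E_\alpha$. Then this recursion defines a unique class sequence $(M_\alpha,E_\alpha)_{\alpha\in On}$, and $(M,E)$ is a model of $\mathrm{ZF}^-$. Moreover, if $V$ is a model of $\mathrm{ZFC}^-$ ($=\mathrm{ZF}^-$ plus the Axiom of Choice), then $(M,E)$ is a model of $\mathrm{ZFC}^-$. -/

import Mathlib

namespace ClassModel

universe u

/-! ### The first-order language of set theory and classes -/

/-- The relation symbols of the language of set theory: one binary symbol. -/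
inductive MemSymb : ℕ → Type
  | mem : MemSymb 2

/-- The first-order language of set theory. -/
def setLang : FirstOrder.Language.{0, 0} := ⟨fun _ => Empty, MemSymb⟩

/-- A binary relation `r` (where `r x y` is read `x ∈ y`), as a first-order structure. -/
@[reducible] def setStructure {V : Type u} (r : V → V → Prop) : setLang.Structure V where
  funMap := fun f => nomatch f
  RelMap := fun s => match s with
    | MemSymb.mem => fun v => r (v 0) (v 1)

/-- `s ⊆ Vⁿ` is first-order definable in `(V, r)` with parameters from `V`. -/
def IsDefinable {V : Type u} (r : V → V → Prop) {n : ℕ} (s : Set (Fin n → V)) : Prop :=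
  letI := setStructure r
  Set.Definable (Set.univ : Set V) setLang s

/-- A class of `(V, r)`: a unary predicate definable with parameters. -/
def IsClass₁ {V : Type u} (r : V → V → Prop) (P : V → Prop) : Prop :=
  IsDefinable r {p : Fin 1 → V | P (p 0)}

/-- A binary class relation of `(V, r)`. -/
def IsClass₂ {V : Type u} (r : V → V → Prop) (P : V → V → Prop) : Prop :=
  IsDefinable r {p : Fin 2 → V | P (p 0) (p 1)}

/-- A ternary class relation of `(V, r)`. -/
def IsClass₃ {V : Type u} (r : V → V → Prop) (P : V → V → V → Prop) : Prop :=
  IsDefinable r {p : Fin 3 → V | P (p 0) (p 1) (p 2)}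

/-! ### The axioms -/

/-- `(V, r)` satisfies Extensionality. -/
def Extensionality {V : Type u} (r : V → V → Prop) : Prop :=
  ∀ x y, (∀ z, r z x ↔ r z y) → x = y

/-- `(V, r)` satisfies Empty Set. -/
def EmptySet {V : Type u} (r : V → V → Prop) : Prop :=
  ∃ x, ∀ z, ¬ r z x

/-- `y = x ∪ {x}` in `(V, r)`. -/
def IsSucc {V : Type u} (r : V → V → Prop) (x y : V) : Prop :=
  ∀ z, r z y ↔ r z x ∨ z = x

/-- `(V, r)` is a model of ZF minus the axiom of regularity. The Separation and Replacement
schemas range over first-order formulas with parameters. -/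
structure IsModelZFMinus {V : Type u} (r : V → V → Prop) : Prop where
  extensionality : Extensionality r
  pairing : ∀ x y, ∃ a, ∀ z, r z a ↔ z = x ∨ z = y
  union : ∀ a, ∃ b, ∀ z, r z b ↔ ∃ x, r x a ∧ r z x
  powerSet : ∀ a, ∃ b, ∀ x, r x b ↔ ∀ z, r z x → r z a
  infinity : ∃ a, (∃ e, r e a ∧ ∀ z, ¬ r z e) ∧ ∀ x, r x a → ∃ y, r y a ∧ IsSucc r x y
  separation : ∀ P : V → Prop, IsClass₁ r P → ∀ a, ∃ b, ∀ z, r z b ↔ r z a ∧ P z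
  replacement : ∀ F : V → V → Prop, IsClass₂ r F →
    (∀ x y y', F x y → F x y' → y = y') →
    ∀ a, ∃ b, ∀ y, r y b ↔ ∃ x, r x a ∧ F x y

/-- The axiom of choice in `(V, r)`: every set of nonempty pairwise disjoint sets has a
choice set, i.e. a set meeting each of them in exactly one element. -/
def Choice {V : Type u} (r : V → V → Prop) : Prop :=
  ∀ a, (∀ x, r x a → ∃ z, r z x) →
    (∀ x y, r x a → r y a → x ≠ y → ∀ z, ¬ (r z x ∧ r z y)) →
    ∃ c, ∀ x, r x a → ∃! z, r z x ∧ r z c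

/-- `(V, r)` is a model of ZFC minus the axiom of regularity. -/
structure IsModelZFCMinus {V : Type u} (r : V → V → Prop) : Prop where
  zf : IsModelZFMinus r
  choice : Choice r

/-! ### Transitive closure and ordinals, inside `(V, r)` -/

/-- `t` is a transitive set of `(V, r)`. -/
def IsTrans {V : Type u} (r : V → V → Prop) (t : V) : Prop :=
  ∀ x, r x t → ∀ z, r z x → r z t

/-- `x ∈ tc(y)`, where `tc(y)` is the least transitive set including `y`. -/
def InTC {V : Type u} (r : V → V → Prop) (x y : V) : Prop :=
  ∀ t, IsTrans r t → (∀ z, r z y → r z t) → r x t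

/-- `a` is an ordinal of `(V, r)`: a transitive set, totally and well-foundedly ordered by
membership (regularity is not available, so well-foundedness is part of the definition;
irreflexivity and transitivity of the order follow from it). -/
structure IsOrdinal {V : Type u} (r : V → V → Prop) (a : V) : Prop where
  trans : IsTrans r a
  total : ∀ x y, r x a → r y a → r x y ∨ x = y ∨ r y x
  wf : ∀ s, (∃ x, r x s) → (∀ x, r x s → r x a) → ∃ m, r m s ∧ ∀ x, r x s → ¬ r x m

/-- The ordinals of `(V, r)`. -/
abbrev OrdinalOf {V : Type u} (r : V → V → Prop) : Type u := {a : V // IsOrdinal r a}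

/-- `a` is a limit ordinal: neither zero nor a successor. -/
def IsLimitOrd {V : Type u} (r : V → V → Prop) (a : OrdinalOf r) : Prop :=
  (∃ x, r x a.1) ∧ ∀ b : OrdinalOf r, ¬ IsSucc r b.1 a.1

/-! ### The iteration -/

/-- A collection of elements of `V` together with a binary relation. -/
@[ext]
structure Str (V : Type u) where
  carrier : Set V
  rel : V → V → Prop

/-- The relation of a structure, restricted to its carrier. -/
def Str.on {V : Type u} (A : Str V) : A.carrier → A.carrier → Prop :=
  fun x y => A.rel x y

/-- `A` is a class structure of `(V, r)`: its carrier is a class, its relation is a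
class of pairs of elements of the carrier. -/
structure Str.IsClassStr {V : Type u} (r : V → V → Prop) (A : Str V) : Prop where
  carrier_class : IsClass₁ r (fun x => x ∈ A.carrier)
  rel_class : IsClass₂ r A.rel
  rel_sub : ∀ x y, A.rel x y → x ∈ A.carrier ∧ y ∈ A.carrier

/-- `v` represents the set `y` in `A`: `y = {u : u R v}`. -/
def Str.Represents {V : Type u} (r : V → V → Prop) (A : Str V) (v y : V) : Prop :=
  ∀ u, r u y ↔ u ∈ A.carrier ∧ A.rel u v

/-- The class of all nonempty sets `y ⊆ A` which no element of `A` represents. -/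
def Str.unrep {V : Type u} (r : V → V → Prop) (A : Str V) : Set V :=
  {y | (∃ u, r u y) ∧ (∀ u, r u y → u ∈ A.carrier) ∧
    ¬ ∃ v ∈ A.carrier, A.Represents r v y}

/-- One step: add all nonempty unrepresented sets `y ⊆ A`, whose predecessors in the new
structure are their elements. -/
def Str.next {V : Type u} (r : V → V → Prop) (A : Str V) : Str V where
  carrier := A.carrier ∪ A.unrep r
  rel := fun x y => A.rel x y ∨ (x ∈ A.carrier ∧ y ∈ A.unrep r ∧ r x y)

/-- `H` is the iteration of the step over the ordinals of `(V, r)`, starting from `A`: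
a class family of structures which is `A` at zero, obeys the step at successors, and is the
union of the preceding structures at limits. -/
structure IsIteration {V : Type u} (r : V → V → Prop) (A : Str V) (H : OrdinalOf r → Str V) :
    Prop where
  carrier_class : IsClass₂ r (fun a x => ∃ h : IsOrdinal r a, x ∈ (H ⟨a, h⟩).carrier)
  rel_class : IsClass₃ r (fun a x y => ∃ h : IsOrdinal r a, (H ⟨a, h⟩).rel x y)
  zero : ∀ a : OrdinalOf r, (∀ x, ¬ r x a.1) → H a = A
  succ : ∀ a b : OrdinalOf r, IsSucc r a.1 b.1 → H b = (H a).next r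
  limit : ∀ a : OrdinalOf r, IsLimitOrd r a →
    H a = { carrier := {x | ∃ b : OrdinalOf r, r b.1 a.1 ∧ x ∈ (H b).carrier}
            rel := fun x y => ∃ b : OrdinalOf r, r b.1 a.1 ∧ (H b).rel x y }

/-- The union of a family of structures over all ordinals. -/
def unionStr {V : Type u} (r : V → V → Prop) (H : OrdinalOf r → Str V) : Str V where
  carrier := {x | ∃ a, x ∈ (H a).carrier}
  rel := fun x y => ∃ a, (H a).rel x y

end ClassModel

open ClassModel

/-!
Besides the elements of `A`, the iteration produces nonempty sets `y` which `A` does not represent.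
Call such sets *fresh*. By induction on the stages, every set obtained has an element of `A` in the
transitive closure of its singleton; as no element of `A` lies in the transitive closure of an
element of `A`, new sets never belong to `A`. A new set therefore has exactly its elements as predecessors and
represents itself, so the levels satisfy
`M_a = A ∪ {y | y is fresh and y ⊆ M_b for some b < a}` (`Str.level_iff`).

*Existence and uniqueness.* The levels may be proper classes, so they cannot be collected into a
sequence of sets, and the recursion needs another definition. Membership `x ∈ M_a` is witnessed
by a set of pairs `(z, b)`, a certificate, in which every pair is justified by pairs with a smaller
second coordinate. This is a first-order condition, and the recursive clause holds because every
set is included in a transitive set, on which the certified pairs form a single certificate. So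
the stages form an iteration (`isIteration_stage`). It is unique by induction on the ordinals,
since the ordinals at which two class families agree form a class (`IsIteration.unique`).

*The axioms.* In the union `B` of the stages, every set of elements of `B` is represented: either
in `A`, or, as replacement bounds the stages of its elements, by itself at a later stage. So `B` is
*full* (`isFull_unionStr_stage`): its elements correspond to the sets `y ⊆ B`. Each axiom
asserts that a certain class is a set, and this holds in `V`. For the schemas, a class of `B` pulls
back to a class of `V` along a retraction of `V` onto `B` (`IsDefinable.interpret`). For Infinity,
recursion on the ordinals of `V` gives a map `F` for which `F a` represents `{F b | b < a}`. A choice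
set in `B` comes from a choice set in `V` for the extents.

Inductions and separations need their predicates to be classes. These obligations are left to
instance search, through the class `Dfn` of definable predicates.
-/

namespace ClassModel

open FirstOrder FirstOrder.Language

universe u

/-! ### Definability with parameters, by instance search -/

/-- A term of the language of set theory with parameters, evaluated at assignments of the
variables `0, 1, 2, …`: a variable or a parameter. -/
class IsTerm {V : Type u} (t : (ℕ → V) → V) : Prop where
  var_or_const : (∃ k, ∀ v, t v = v k) ∨ ∃ c, ∀ v, t v = c

/-- The predicate `P` on assignments of the variables `0, 1, 2, …` is given by a first-order
formula over `(V, r)` with parameters. Variables are counted from the innermost quantifier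
outwards, so that closure under the logical operations can be found by instance search. -/
class Dfn {V : Type u} (r : V → V → Prop) (P : (ℕ → V) → Prop) : Prop where
  definable : letI := setStructure r
    Set.Definable (Set.univ : Set V) setLang {v : ℕ → V | P v}

section Definability

variable {V : Type u} {r : V → V → Prop}

instance IsTerm.var (k : ℕ) : IsTerm (fun v : ℕ → V => v k) := ⟨.inl ⟨k, fun _ => rfl⟩⟩

instance IsTerm.const (c : V) : IsTerm (fun _ : ℕ → V => c) := ⟨.inr ⟨c, fun _ => rfl⟩⟩

theorem IsTerm.shift {t : (ℕ → V) → V} (ht : IsTerm t) :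
    IsTerm (fun v : ℕ → V => t fun n => v (n + 1)) := by
  rcases ht.var_or_const with ⟨k, h⟩ | ⟨c, h⟩
  · exact ⟨.inl ⟨k + 1, fun v => by rw [h]⟩⟩
  · exact ⟨.inr ⟨c, fun v => by rw [h]⟩⟩

theorem IsTerm.exists_term (r : V → V → Prop) {t : (ℕ → V) → V} (ht : IsTerm t) :
    letI := setStructure r
    ∃ τ : (setLang[[(Set.univ : Set V)]]).Term ℕ, ∀ v, τ.realize v = t v := by
  let := setStructure r
  rcases ht.var_or_const with ⟨k, h⟩ | ⟨c, h⟩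
  · exact ⟨Term.var k, fun v => by simp [h]⟩
  · exact ⟨(setLang.con (⟨c, trivial⟩ : (Set.univ : Set V))).term, fun v => by simp [h]⟩

theorem Dfn.congr {P Q : (ℕ → V) → Prop} (hP : Dfn r P) (h : ∀ v, Q v ↔ P v) : Dfn r Q := by
  rwa [funext fun v => propext (h v)]

/-- Substitution of terms for the variables of a definable set. -/
theorem IsDefinable.subst {n : ℕ} {s : Set (Fin n → V)} (hs : IsDefinable r s)
    (t : Fin n → (ℕ → V) → V) (ht : ∀ i, IsTerm (t i)) :
    Dfn r (fun v => (fun i => t i v) ∈ s) := by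
  let := setStructure r
  obtain ⟨φ, rfl⟩ := hs
  choose τ hτ using fun i => (ht i).exists_term r
  refine ⟨⟨BoundedFormula.subst φ τ, ?_⟩⟩
  ext v
  simp [Formula.Realize, BoundedFormula.realize_subst, hτ]

theorem IsClass₁.dfn {P : V → Prop} (hP : IsClass₁ r P) (s : (ℕ → V) → V) [hs : IsTerm s] :
    Dfn r (fun v => P (s v)) :=
  IsDefinable.subst hP (fun _ => s) fun _ => hs

theorem IsClass₂.dfn {P : V → V → Prop} (hP : IsClass₂ r P) (s t : (ℕ → V) → V)
    [hs : IsTerm s] [ht : IsTerm t] : Dfn r (fun v => P (s v) (t v)) :=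
  IsDefinable.subst hP ![s, t] (by simp [Fin.forall_fin_two, hs, ht])

theorem IsClass₃.dfn {P : V → V → V → Prop} (hP : IsClass₃ r P) (s t w : (ℕ → V) → V)
    [hs : IsTerm s] [ht : IsTerm t] [hw : IsTerm w] : Dfn r (fun v => P (s v) (t v) (w v)) :=
  IsDefinable.subst hP ![s, t, w] (by simp [Fin.forall_fin_succ, hs, ht, hw])

theorem Dfn.isDefinable {n : ℕ} {P : (ℕ → V) → Prop} (hP : Dfn r P) (f : ℕ → Fin n) :
    IsDefinable r {p : Fin n → V | P fun k => p (f k)} :=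
  letI := setStructure r
  hP.definable.preimage_comp f

theorem Dfn.isClass₁ {P : V → Prop} (hP : Dfn r fun v => P (v 0)) : IsClass₁ r P :=
  hP.isDefinable fun _ => 0

theorem Dfn.isClass₂ {P : V → V → Prop} (hP : Dfn r fun v => P (v 0) (v 1)) : IsClass₂ r P :=
  hP.isDefinable fun k => if k = 0 then 0 else 1

theorem Dfn.isClass₃ {P : V → V → V → Prop} (hP : Dfn r fun v => P (v 0) (v 1) (v 2)) :
    IsClass₃ r P :=
  hP.isDefinable fun k => if k = 0 then 0 else if k = 1 then 1 else 2

instance Dfn.const (p : Prop) : Dfn r (fun _ => p) := by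
  let := setStructure r
  refine ⟨?_⟩
  by_cases hp : p
  · simp [hp]
  · simp [hp]

instance Dfn.not {P : (ℕ → V) → Prop} [hP : Dfn r P] : Dfn r (fun v => ¬ P v) :=
  letI := setStructure r
  ⟨hP.definable.compl⟩

instance Dfn.and {P Q : (ℕ → V) → Prop} [hP : Dfn r P] [hQ : Dfn r Q] :
    Dfn r (fun v => P v ∧ Q v) :=
  letI := setStructure r
  ⟨hP.definable.inter hQ.definable⟩

instance Dfn.or {P Q : (ℕ → V) → Prop} [hP : Dfn r P] [hQ : Dfn r Q] :
    Dfn r (fun v => P v ∨ Q v) :=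
  letI := setStructure r
  ⟨hP.definable.union hQ.definable⟩

instance Dfn.imp {P Q : (ℕ → V) → Prop} [Dfn r P] [Dfn r Q] : Dfn r (fun v => P v → Q v) :=
  (inferInstance : Dfn r fun v => ¬ P v ∨ Q v).congr fun _ => imp_iff_not_or

instance Dfn.iff {P Q : (ℕ → V) → Prop} [Dfn r P] [Dfn r Q] : Dfn r (fun v => (P v ↔ Q v)) :=
  (inferInstance : Dfn r fun v => (P v → Q v) ∧ (Q v → P v)).congr
    fun _ => iff_iff_implies_and_implies

instance Dfn.all {P : (ℕ → V) → V → Prop} [hP : Dfn r fun v => P (fun n => v (n + 1)) (v 0)] :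
    Dfn r (fun v => ∀ x, P v x) := by
  let := setStructure r
  obtain ⟨φ, hφ⟩ := hP.definable
  let g : ℕ → ℕ ⊕ Fin 1 := fun k => Nat.casesOn k (.inr 0) .inl
  refine ⟨⟨(BoundedFormula.relabel g φ : BoundedFormula _ ℕ 1).all, ?_⟩⟩
  ext v
  simp only [Set.ext_iff, Set.mem_ofPred_eq] at hφ ⊢
  refine forall_congr' fun x => ?_
  rw [BoundedFormula.realize_relabel]
  have h : P v x ↔ φ.Realize _ := hφ fun k => Nat.casesOn k x v
  rw [h, Formula.Realize]
  refine iff_of_eq ?_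
  congr 1
  · funext k
    cases k <;> simp [g, Fin.snoc]
  · exact Subsingleton.elim _ _

instance Dfn.ex {P : (ℕ → V) → V → Prop} [Dfn r fun v => P (fun n => v (n + 1)) (v 0)] :
    Dfn r (fun v => ∃ x, P v x) :=
  (inferInstance : Dfn r fun v => ¬ ∀ x, ¬ P v x).congr fun _ => not_forall_not.symm

instance Dfn.mem {s t : (ℕ → V) → V} [hs : IsTerm s] [ht : IsTerm t] :
    Dfn r (fun v => r (s v) (t v)) := by
  let := setStructure r
  have h : IsClass₂ r r := by
    refine (Set.empty_definable_iff.2 ⟨Relations.formula₂ (L := setLang) MemSymb.mem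
      (Term.var 0) (Term.var 1), ?_⟩).mono (Set.empty_subset _)
    ext v
    rfl
  exact h.dfn s t

instance Dfn.eq {s t : (ℕ → V) → V} [hs : IsTerm s] [ht : IsTerm t] :
    Dfn r (fun v => s v = t v) := by
  let := setStructure r
  obtain ⟨σ, hσ⟩ := hs.exists_term r
  obtain ⟨τ, hτ⟩ := ht.exists_term r
  refine ⟨⟨σ.equal τ, ?_⟩⟩
  ext v
  simp [hσ, hτ]

/-! ### Definability in an interpreted structure -/

section Interpretation

variable {M : Type u} {E : M → M → Prop} {c : V → M}

/-- Terms of the language of `(M, E)` are variables and parameters, so along a surjection `c` they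
pull back to terms over `V`. -/
theorem exists_isTerm_realize (hc : Function.Surjective c) {β : Type} :
    letI := setStructure E
    ∀ (t : (setLang[[(Set.univ : Set M)]]).Term β) (ρ : β → (ℕ → V) → V), (∀ b, IsTerm (ρ b)) →
      ∃ s : (ℕ → V) → V, IsTerm s ∧ ∀ w, t.realize (fun b => c (ρ b w)) = c (s w) := by
  let := setStructure E
  rintro (b | @⟨l, f, ts⟩) ρ hρ
  · exact ⟨ρ b, hρ b, fun w => rfl⟩
  · rcases f with f | f
    · exact nomatch f
    · match l, f with
      | 0, f =>
        obtain ⟨x, hx⟩ := hc (Term.realize (L := setLang[[(Set.univ : Set M)]])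
          (fun b : Empty => nomatch b) (Term.func (Sum.inr f) Fin.elim0))
        refine ⟨fun _ => x, inferInstance, fun w => ?_⟩
        rw [hx]
        simp only [Term.realize]
        congr 1
        exact Subsingleton.elim _ _
      | _ + 1, f => exact nomatch f

/-- Formulas over `(M, E)`, with free and bound variables replaced by images of terms over `V`,
define classes of `V`. -/
theorem dfn_realize (hc : Function.Surjective c)
    (hE : IsClass₂ r fun x y => E (c x) (c y)) (heq : IsClass₂ r fun x y => c x = c y)
    {α : Type} {n : ℕ} :
    letI := setStructure E
    ∀ (φ : (setLang[[(Set.univ : Set M)]]).BoundedFormula α n)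
      (σ : α → (ℕ → V) → V) (τ : Fin n → (ℕ → V) → V), (∀ a, IsTerm (σ a)) → (∀ i, IsTerm (τ i)) →
      Dfn r fun w => φ.Realize (fun a => c (σ a w)) (fun i => c (τ i w)) := by
  let := setStructure E
  intro φ
  have elim : ∀ {n} (σ : α → (ℕ → V) → V) (τ : Fin n → (ℕ → V) → V) (w : ℕ → V),
      (Sum.elim (fun a => c (σ a w)) fun i => c (τ i w)) = fun b => c (Sum.elim σ τ b w) := by
    intro n σ τ w
    funext b
    cases b <;> rfl
  induction φ with
  | falsum => exact fun _ _ _ _ => Dfn.const False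
  | equal t₁ t₂ =>
    intro σ τ hσ hτ
    obtain ⟨s₁, h₁, e₁⟩ := exists_isTerm_realize hc t₁ (Sum.elim σ τ) (by simp [hσ, hτ])
    obtain ⟨s₂, h₂, e₂⟩ := exists_isTerm_realize hc t₂ (Sum.elim σ τ) (by simp [hσ, hτ])
    refine (heq.dfn s₁ s₂).congr fun w => ?_
    rw [← e₁, ← e₂, BoundedFormula.Realize, elim]
  | @rel n l R ts =>
    intro σ τ hσ hτ
    rcases R with R | R
    · cases R
      obtain ⟨s₁, h₁, e₁⟩ := exists_isTerm_realize hc (ts 0) (Sum.elim σ τ) (by simp [hσ, hτ])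
      obtain ⟨s₂, h₂, e₂⟩ := exists_isTerm_realize hc (ts 1) (Sum.elim σ τ) (by simp [hσ, hτ])
      refine (hE.dfn s₁ s₂).congr fun w => ?_
      rw [← e₁, ← e₂, ← elim]
      rfl
    · match l, R with
      | 0, R => exact nomatch R
      | 1, R => exact nomatch R
      | _ + 2, R => exact nomatch R
  | imp φ ψ hφ hψ =>
    intro σ τ hσ hτ
    have := hφ σ τ hσ hτ
    have := hψ σ τ hσ hτ
    exact Dfn.imp
  | @all n φ ih =>
    intro σ τ hσ hτ
    have h := ih (fun a w => σ a fun n => w (n + 1))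
      (Fin.snoc (α := fun _ => (ℕ → V) → V) (fun i w => τ i fun n => w (n + 1)) fun w => w 0)
      (fun a => (hσ a).shift) (Fin.lastCases (by simpa using IsTerm.var 0) fun i => by
        simpa using (hτ i).shift)
    have h' : Dfn r fun w => φ.Realize (fun a => c (σ a fun n => w (n + 1)))
        (Fin.snoc (fun i => c (τ i fun n => w (n + 1))) (c (w 0))) := by
      refine h.congr fun w => iff_of_eq ?_
      congr 1
      funext i
      cases i using Fin.lastCases <;> simp
    refine (Dfn.all (P := fun w x => φ.Realize (fun a => c (σ a w))
        (Fin.snoc (fun i => c (τ i w)) (c x)))).congr fun w => ?_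
    exact hc.forall

/-- A structure `(M, E)` which is the image of a class function `c` on `V`, with definable
relation and equality, has only classes that pull back to classes of `V`. Since `c` maps onto `M`,
no relativization of quantifiers is involved. -/
theorem IsDefinable.interpret (hc : Function.Surjective c)
    (hE : IsClass₂ r fun x y => E (c x) (c y)) (heq : IsClass₂ r fun x y => c x = c y)
    {n : ℕ} {s : Set (Fin n → M)} (hs : IsDefinable E s) :
    Dfn r fun w => (fun i : Fin n => c (w i)) ∈ s := by
  let := setStructure E
  obtain ⟨φ, rfl⟩ := hs
  refine (dfn_realize hc hE heq φ (fun i w => w i) Fin.elim0 (fun i => inferInstance)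
    (fun i => i.elim0)).congr fun w => ?_
  rw [Set.mem_ofPred_eq, Formula.Realize]
  refine iff_of_eq ?_
  congr 1
  exact Subsingleton.elim _ _

end Interpretation

end Definability

variable {V : Type u} {r : V → V → Prop}

/-! ### Small classes -/

/-- The class `P` is a set of `(V, r)`. -/
def Small (r : V → V → Prop) (P : V → Prop) : Prop := ∃ b, ∀ z, r z b ↔ P z

theorem small_mem (a : V) : Small r fun z => r z a := ⟨a, fun _ => Iff.rfl⟩

theorem Small.congr {P Q : V → Prop} (hP : Small r P) (h : ∀ z, Q z ↔ P z) : Small r Q := by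
  rwa [funext fun z => propext (h z)]

namespace IsModelZFMinus

variable (hV : IsModelZFMinus r)
include hV

theorem ext {x y : V} (h : ∀ z, r z x ↔ r z y) : x = y := hV.extensionality x y h

theorem small_subset {P : V → Prop} (hP : Small r P) (Q : V → Prop) [hQ : Dfn r fun v => Q (v 0)]
    (h : ∀ z, Q z → P z) : Small r Q := by
  obtain ⟨a, ha⟩ := hP
  obtain ⟨b, hb⟩ := hV.separation Q hQ.isClass₁ a
  exact ⟨b, fun z => (hb z).trans ⟨And.right, fun hz => ⟨(ha z).2 (h z hz), hz⟩⟩⟩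

theorem small_image {P : V → Prop} (hP : Small r P) (F : V → V → Prop)
    [hF : Dfn r fun v => F (v 0) (v 1)] (h : ∀ x y y', F x y → F x y' → y = y') :
    Small r fun y => ∃ x, P x ∧ F x y := by
  obtain ⟨a, ha⟩ := hP
  obtain ⟨b, hb⟩ := hV.replacement F hF.isClass₂ h a
  exact ⟨b, fun z => by simp only [hb, ha]⟩

theorem small_sUnion {P : V → Prop} (hP : Small r P) : Small r fun z => ∃ x, P x ∧ r z x := by
  obtain ⟨a, ha⟩ := hP
  obtain ⟨b, hb⟩ := hV.union a
  exact ⟨b, fun z => by simp only [hb, ha]⟩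

theorem small_biUnion {P : V → Prop} (hP : Small r P) (Q : V → V → Prop)
    [hQ : Dfn r fun v => Q (v 0) (v 1)] (h : ∀ x, P x → Small r (Q x)) :
    Small r fun y => ∃ x, P x ∧ Q x y := by
  have := fun (s t : (ℕ → V) → V) [IsTerm s] [IsTerm t] => hQ.isClass₂.dfn s t
  have hF := hV.small_sUnion (hV.small_image hP (fun x s => ∀ z, r z s ↔ Q x z)
    fun x y y' hy hy' => hV.ext fun z => (hy z).trans (hy' z).symm)
  refine hF.congr fun z => ⟨?_, ?_⟩
  · rintro ⟨x, hx, hz⟩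
    obtain ⟨s, hs⟩ := h x hx
    exact ⟨s, ⟨x, hx, hs⟩, (hs z).2 hz⟩
  · rintro ⟨s, ⟨x, hx, hs⟩, hz⟩
    exact ⟨x, hx, (hs z).1 hz⟩

theorem small_pair (x y : V) : Small r fun z => z = x ∨ z = y := hV.pairing x y

theorem small_singleton (x : V) : Small r fun z => z = x :=
  (hV.small_pair x x).congr fun _ => (or_self_iff).symm

theorem small_or {P Q : V → Prop} (hP : Small r P) (hQ : Small r Q) :
    Small r fun z => P z ∨ Q z := by
  obtain ⟨a, ha⟩ := hP
  obtain ⟨b, hb⟩ := hQ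
  refine (hV.small_sUnion (hV.small_pair a b)).congr fun z => ?_
  simp [← ha, ← hb]

theorem small_powerSet {P : V → Prop} (hP : Small r P) :
    Small r fun x => ∀ z, r z x → P z := by
  obtain ⟨a, ha⟩ := hP
  obtain ⟨b, hb⟩ := hV.powerSet a
  exact ⟨b, fun z => by simp only [hb, ha]⟩

theorem exists_empty : ∃ e, ∀ z, ¬ r z e := by
  obtain ⟨_, ⟨e, _, he⟩, _⟩ := hV.infinity
  exact ⟨e, he⟩

theorem exists_isSucc (x : V) : ∃ y, IsSucc r x y :=
  hV.small_or (small_mem x) (hV.small_singleton x)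

end IsModelZFMinus

/-! ### Ordered pairs and sets of pairs -/

/-- `p` is the Kuratowski pair `{{x}, {x, y}}`. -/
def IsPair (r : V → V → Prop) (x y p : V) : Prop :=
  ∀ z, r z p ↔ (∀ w, r w z ↔ w = x) ∨ (∀ w, r w z ↔ w = x ∨ w = y)

/-- The ordered pair of `x` and `y` belongs to `f`. -/
def PairMem (r : V → V → Prop) (f x y : V) : Prop := ∃ p, r p f ∧ IsPair r x y p

instance IsPair.dfn (s t w : (ℕ → V) → V) [IsTerm s] [IsTerm t] [IsTerm w] :
    Dfn r fun v => IsPair r (s v) (t v) (w v) := by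
  have h : Dfn r fun v => IsPair r (v 0) (v 1) (v 2) := by unfold IsPair; infer_instance
  exact h.isClass₃.dfn s t w

instance PairMem.dfn (s t w : (ℕ → V) → V) [IsTerm s] [IsTerm t] [IsTerm w] :
    Dfn r fun v => PairMem r (s v) (t v) (w v) := by
  have h : Dfn r fun v => PairMem r (v 0) (v 1) (v 2) := by unfold PairMem; infer_instance
  exact h.isClass₃.dfn s t w

theorem IsPair.inj {x y x' y' p : V} (hV : IsModelZFMinus r) (h : IsPair r x y p)
    (h' : IsPair r x' y' p) : x = x' ∧ y = y' := by
  obtain ⟨a, ha⟩ := hV.small_singleton x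
  obtain ⟨b, hb⟩ := hV.small_pair x y
  obtain ⟨b', hb'⟩ := hV.small_pair x' y'
  have hx : x = x' := by
    rcases (h' a).1 ((h a).2 (.inl ha)) with k | k
    · exact (k x).1 ((ha x).2 rfl)
    · exact ((ha x').1 ((k x').2 (.inl rfl))).symm
  subst hx
  refine ⟨rfl, ?_⟩
  have h1 : y = x ∨ y = y' := by
    rcases (h' b).1 ((h b).2 (.inr hb)) with k | k
    · exact .inl ((k y).1 ((hb y).2 (.inr rfl)))
    · exact (k y).1 ((hb y).2 (.inr rfl))
  have h2 : y' = x ∨ y' = y := by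
    rcases (h b').1 ((h' b').2 (.inr hb')) with k | k
    · exact .inl ((k y').1 ((hb' y').2 (.inr rfl)))
    · exact (k y').1 ((hb' y').2 (.inr rfl))
  grind

namespace IsModelZFMinus

variable (hV : IsModelZFMinus r)
include hV

theorem exists_isPair (x y : V) : ∃ p, IsPair r x y p := by
  obtain ⟨a, ha⟩ := hV.small_singleton x
  obtain ⟨b, hb⟩ := hV.small_pair x y
  refine (hV.small_pair a b).congr fun z =>
    or_congr ⟨fun k => ?_, fun k => ?_⟩ ⟨fun k => ?_, fun k => ?_⟩
  · exact hV.ext fun w => (k w).trans (ha w).symm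
  · exact k ▸ ha
  · exact hV.ext fun w => (k w).trans (hb w).symm
  · exact k ▸ hb

/-- Comprehension for sets of pairs. -/
theorem exists_pairMem {X Y : V → Prop} (hX : Small r X) (hY : Small r Y) (P : V → V → Prop)
    [hP : Dfn r fun v => P (v 0) (v 1)] :
    ∃ f, ∀ x y, PairMem r f x y ↔ X x ∧ Y y ∧ P x y := by
  have := fun (s t : (ℕ → V) → V) [IsTerm s] [IsTerm t] => hP.isClass₂.dfn s t
  obtain ⟨a, ha⟩ := hX
  obtain ⟨b, hb⟩ := hY
  have hs : Small r fun p => ∃ x, r x a ∧ ∃ y, r y b ∧ P x y ∧ IsPair r x y p :=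
    hV.small_biUnion (small_mem a) (fun x p => ∃ y, r y b ∧ P x y ∧ IsPair r x y p) fun x _ =>
      hV.small_image (small_mem b) (fun y p => P x y ∧ IsPair r x y p) fun y p p' h h' =>
        hV.ext fun z => (h.2 z).trans (h'.2 z).symm
  obtain ⟨f, hf⟩ := hs
  refine ⟨f, fun x y => ⟨?_, ?_⟩⟩
  · rintro ⟨p, hp, hxy⟩
    obtain ⟨x', hx', y', hy', h, hp'⟩ := (hf p).1 hp
    obtain ⟨rfl, rfl⟩ := hxy.inj hV hp'
    exact ⟨(ha x).1 hx', (hb y).1 hy', h⟩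
  · rintro ⟨hx, hy, h⟩
    obtain ⟨p, hp⟩ := hV.exists_isPair x y
    exact ⟨p, (hf p).2 ⟨x, (ha x).2 hx, y, (hb y).2 hy, h, hp⟩, hp⟩

end IsModelZFMinus

/-! ### Ordinals -/

instance IsTrans.dfn (s : (ℕ → V) → V) [IsTerm s] : Dfn r fun v => IsTrans r (s v) := by
  have h : Dfn r fun v => IsTrans r (v 0) := by unfold IsTrans; infer_instance
  exact h.isClass₁.dfn s

instance InTC.dfn (s t : (ℕ → V) → V) [IsTerm s] [IsTerm t] :
    Dfn r fun v => InTC r (s v) (t v) := by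
  have h : Dfn r fun v => InTC r (v 0) (v 1) := by unfold InTC; infer_instance
  exact h.isClass₂.dfn s t

instance IsOrdinal.dfn (s : (ℕ → V) → V) [IsTerm s] : Dfn r fun v => IsOrdinal r (s v) := by
  have h : Dfn r fun v => IsTrans r (v 0) ∧
      (∀ x y, r x (v 0) → r y (v 0) → r x y ∨ x = y ∨ r y x) ∧
      ∀ s, (∃ x, r x s) → (∀ x, r x s → r x (v 0)) → ∃ m, r m s ∧ ∀ x, r x s → ¬ r x m :=
    inferInstance
  exact (h.congr fun v => ⟨fun h => ⟨h.1, h.2, h.3⟩, fun h => ⟨h.1, h.2.1, h.2.2⟩⟩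
    : Dfn r fun v => IsOrdinal r (v 0)).isClass₁.dfn s

namespace IsOrdinal

variable (hV : IsModelZFMinus r)
include hV

/-- A nonempty definable part of an ordinal has a minimal element. -/
theorem exists_min {a : V} (ha : IsOrdinal r a) (P : V → Prop) [hP : Dfn r fun v => P (v 0)]
    (h : ∃ x, r x a ∧ P x) : ∃ m, r m a ∧ P m ∧ ∀ x, r x a → P x → ¬ r x m := by
  have := fun (s : (ℕ → V) → V) [IsTerm s] => hP.isClass₁.dfn s
  obtain ⟨s, hs⟩ := hV.small_subset (small_mem a) (fun x => r x a ∧ P x) fun _ => And.left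
  obtain ⟨m, hm, hm'⟩ := ha.wf s (h.imp fun x => (hs x).2) fun x hx => ((hs x).1 hx).1
  exact ⟨m, ((hs m).1 hm).1, ((hs m).1 hm).2, fun x h1 h2 => hm' x ((hs x).2 ⟨h1, h2⟩)⟩

theorem not_mem_self_of_mem {a x : V} (ha : IsOrdinal r a) (hx : r x a) : ¬ r x x := by
  obtain ⟨m, _, rfl, h⟩ := ha.exists_min hV (fun y => y = x) ⟨x, hx, rfl⟩
  exact h m hx rfl

theorem irrefl {a : V} (ha : IsOrdinal r a) : ¬ r a a := fun h =>
  ha.not_mem_self_of_mem hV h h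

theorem mem_trans {a x y z : V} (ha : IsOrdinal r a) (hx : r x a) (hyx : r y x) (hzy : r z y) :
    r z x := by
  have hy := ha.trans x hx y hyx
  have hz := ha.trans y hy z hzy
  rcases ha.total z x hz hx with h | rfl | h
  · exact h
  · obtain ⟨m, _, rfl | rfl, h⟩ := ha.exists_min hV (fun w => w = y ∨ w = z) ⟨y, hy, .inl rfl⟩
    · exact (h z hx (.inr rfl) hzy).elim
    · exact (h y hy (.inl rfl) hyx).elim
  · obtain ⟨m, _, rfl | rfl | rfl, h⟩ :=
      ha.exists_min hV (fun w => w = x ∨ w = y ∨ w = z) ⟨x, hx, .inl rfl⟩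
    · exact (h y hy (.inr (.inl rfl)) hyx).elim
    · exact (h z hz (.inr (.inr rfl)) hzy).elim
    · exact (h x hx (.inl rfl) ‹_›).elim

theorem of_mem {a b : V} (ha : IsOrdinal r a) (hb : r b a) : IsOrdinal r b where
  trans _ hy _ hz := ha.mem_trans hV hb hy hz
  total x y hx hy := ha.total x y (ha.trans b hb x hx) (ha.trans b hb y hy)
  wf s hs hsub := ha.wf s hs fun x hx => ha.trans b hb x (hsub x hx)

theorem induction (P : V → Prop) [hP : Dfn r fun v => P (v 0)]
    (ih : ∀ a, IsOrdinal r a → (∀ b, r b a → P b) → P a) : ∀ a, IsOrdinal r a → P a := by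
  have := fun (s : (ℕ → V) → V) [IsTerm s] => hP.isClass₁.dfn s
  intro a ha
  refine ih a ha fun b hb => ?_
  by_contra hPb
  obtain ⟨m, hm, hPm, h⟩ := ha.exists_min hV (fun x => ¬ P x) ⟨b, hb, hPb⟩
  exact hPm (ih m (ha.of_mem hV hm) fun x hx => by_contra fun hPx =>
    h x (ha.trans m hm x hx) hPx hx)

theorem comparable {a : V} (ha : IsOrdinal r a) : ∀ b, IsOrdinal r b → r a b ∨ a = b ∨ r b a := by
  refine induction hV (fun a => ∀ b, IsOrdinal r b → r a b ∨ a = b ∨ r b a) ?_ a ha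
  intro a ha iha
  refine induction hV (fun b => r a b ∨ a = b ∨ r b a) ?_
  intro b hb ihb
  by_contra! hne
  refine hne.2.1 (hV.ext fun z => ⟨fun hz => ?_, fun hz => ?_⟩)
  · rcases iha z hz b hb with h | rfl | h
    · exact h
    · exact (hne.2.2 hz).elim
    · exact (hne.2.2 (ha.trans z hz b h)).elim
  · rcases ihb z hz with h | rfl | h
    · exact (hne.1 (hb.trans z hz a h)).elim
    · exact (hne.1 hz).elim
    · exact h

/-- Every nonempty class of ordinals has a least element. -/
theorem exists_least (P : V → Prop) [hP : Dfn r fun v => P (v 0)] {a : V} (ha : IsOrdinal r a)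
    (hPa : P a) : ∃ m, IsOrdinal r m ∧ P m ∧ ∀ x, r x m → ¬ P x := by
  have := fun (s : (ℕ → V) → V) [IsTerm s] => hP.isClass₁.dfn s
  by_contra! h
  exact induction hV (fun a => ¬ P a) (fun b hb ih hPb => by
    obtain ⟨x, hx, hPx⟩ := h b hb hPb
    exact ih x hx hPx) a ha hPa

/-- A transitive set of ordinals is an ordinal. -/
theorem of_isTrans {a : V} (ha : IsTrans r a) (h : ∀ x, r x a → IsOrdinal r x) :
    IsOrdinal r a where
  trans := ha
  total x y hx hy := (h x hx).comparable hV y (h y hy)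
  wf s := by
    rintro ⟨x, hx⟩ hs
    obtain ⟨m, -, hm, hm'⟩ := exists_least hV (fun y => r y s) (h x (hs x hx)) hx
    exact ⟨m, hm, fun y hy hym => hm' y hym hy⟩

theorem of_isSucc {a b : V} (ha : IsOrdinal r a) (hab : IsSucc r a b) : IsOrdinal r b := by
  refine of_isTrans hV (fun x hx z hz => (hab z).2 (.inl ?_)) fun x hx => ?_
  · rcases (hab x).1 hx with h | rfl
    · exact ha.trans x h z hz
    · exact hz
  · rcases (hab x).1 hx with h | rfl
    · exact ha.of_mem hV h
    · exact ha

theorem of_empty {e : V} (he : ∀ z, ¬ r z e) : IsOrdinal r e :=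
  of_isTrans hV (fun x hx => (he x hx).elim) fun x hx => (he x hx).elim

/-- A set of ordinals is bounded: all its elements are included in some ordinal. -/
theorem exists_bound {P : V → Prop} (hP : Small r P) (h : ∀ x, P x → IsOrdinal r x) :
    ∃ b, IsOrdinal r b ∧ ∀ x, P x → ∀ z, r z x → r z b := by
  obtain ⟨b, hb⟩ := hV.small_sUnion hP
  refine ⟨b, of_isTrans hV (fun x hx z hz => ?_) fun x hx => ?_, fun x hx z hz =>
    (hb z).2 ⟨x, hx, hz⟩⟩
  · obtain ⟨y, hy, hxy⟩ := (hb x).1 hx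
    exact (hb z).2 ⟨y, hy, (h y hy).trans x hxy z hz⟩
  · obtain ⟨y, hy, hxy⟩ := (hb x).1 hx
    exact (h y hy).of_mem hV hxy

theorem succ_mem_of_mem_limit {a b c : V} (ha : IsOrdinal r a)
    (hlim : IsLimitOrd r ⟨a, ha⟩) (hb : r b a) (hc : IsSucc r b c) : r c a := by
  have hb' := ha.of_mem hV hb
  rcases (hb'.of_isSucc hV hc).comparable hV a ha with h | rfl | h
  · exact h
  · exact (hlim.2 ⟨b, hb'⟩ hc).elim
  · rcases (hc a).1 h with h | rfl
    · exact (hb'.irrefl hV (hb'.trans a h b hb)).elim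
    · exact (ha.irrefl hV hb).elim

end IsOrdinal

/-- There is a set of ordinals containing zero and closed under successors. -/
theorem IsModelZFMinus.exists_inductive_ordinals (hV : IsModelZFMinus r) :
    ∃ a, (∀ n, r n a → IsOrdinal r n) ∧ (∃ e, r e a ∧ ∀ z, ¬ r z e) ∧
      ∀ n, r n a → ∃ m, r m a ∧ IsSucc r n m := by
  obtain ⟨a, ⟨e, hea, he⟩, ha⟩ := hV.infinity
  obtain ⟨b, hb⟩ := hV.small_subset (small_mem a) (fun x => r x a ∧ IsOrdinal r x) fun _ => And.left
  refine ⟨b, fun n hn => ((hb n).1 hn).2, ⟨e, (hb e).2 ⟨hea, IsOrdinal.of_empty hV he⟩, he⟩, ?_⟩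
  intro n hn
  obtain ⟨hna, hn⟩ := (hb n).1 hn
  obtain ⟨m, hma, hm⟩ := ha n hna
  exact ⟨m, (hb m).2 ⟨hma, hn.of_isSucc hV hm⟩, hm⟩

/-! ### Recursion on the ordinals -/

/-- The value of a class function on the set `a` of arguments: `s = {F j : j ∈ a}`. -/
def IsImage (r : V → V → Prop) (F : V → V) (a s : V) : Prop :=
  ∀ y, r y s ↔ ∃ j, r j a ∧ F j = y

/-- The set of pairs `f` is closed downwards in its first coordinate and obeys the recursion
`f(k) = G {f(j) : j ∈ k}`. -/
def IsRecursive (r G : V → V → Prop) (f : V) : Prop :=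
  ∀ k x, PairMem r f k x → (∀ j, r j k → ∃ y, PairMem r f j y) ∧
    ∃ s, (∀ y, r y s ↔ ∃ j, r j k ∧ PairMem r f j y) ∧ G s x

section Recursion

variable (hV : IsModelZFMinus r) {G : V → V → Prop} [hG : Dfn r fun v => G (v 0) (v 1)]
  (hG' : ∀ s, ∃! x, G s x)
include hV hG hG'

theorem IsRecursive.unique {a : V} (ha : IsOrdinal r a) : ∀ f f' x x', IsRecursive r G f →
    IsRecursive r G f' → PairMem r f a x → PairMem r f' a x' → x = x' := by
  have := fun (s t : (ℕ → V) → V) [IsTerm s] [IsTerm t] => hG.isClass₂.dfn s t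
  have hR : Dfn r fun v => IsRecursive r G (v 0) := by unfold IsRecursive; infer_instance
  have := fun (s : (ℕ → V) → V) [IsTerm s] => hR.isClass₁.dfn s
  refine IsOrdinal.induction hV (fun a => ∀ f f' x x', IsRecursive r G f →
    IsRecursive r G f' → PairMem r f a x → PairMem r f' a x' → x = x') ?_ a ha
  intro a _ ih f f' x x' hf hf' hx hx'
  obtain ⟨hd, s, hs, hsx⟩ := hf a x hx
  obtain ⟨hd', s', hs', hsx'⟩ := hf' a x' hx'
  have : s = s' := hV.ext fun y => by
    rw [hs, hs']
    refine exists_congr fun j => and_congr_right fun hj => ⟨fun hy => ?_, fun hy => ?_⟩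
    · obtain ⟨y', hy'⟩ := hd' j hj
      rwa [ih j hj f f' y y' hf hf' hy hy']
    · obtain ⟨y', hy'⟩ := hd j hj
      rwa [← ih j hj f f' y' y hf hf' hy' hy]
  subst this
  exact (hG' s).unique hsx hsx'

theorem IsRecursive.exists {a : V} (ha : IsOrdinal r a) :
    ∃ x f, IsRecursive r G f ∧ PairMem r f a x := by
  have := fun (s t : (ℕ → V) → V) [IsTerm s] [IsTerm t] => hG.isClass₂.dfn s t
  have hR : Dfn r fun v => IsRecursive r G (v 0) := by unfold IsRecursive; infer_instance
  have := fun (s : (ℕ → V) → V) [IsTerm s] => hR.isClass₁.dfn s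
  refine IsOrdinal.induction hV (fun a => ∃ x f, IsRecursive r G f ∧ PairMem r f a x) ?_ a ha
  intro a ha ih
  let F : V → V → Prop := fun k y => r k a ∧ ∃ f, IsRecursive r G f ∧ PairMem r f k y
  have hF : ∀ k y y', F k y → F k y' → y = y' := by
    rintro k y y' ⟨hk, f, hf, hy⟩ ⟨-, f', hf', hy'⟩
    exact IsRecursive.unique hV hG' (ha.of_mem hV hk) f f' y y' hf hf' hy hy'
  have hFd : Dfn r fun v => F (v 0) (v 1) := by unfold F; infer_instance
  have := fun (s t : (ℕ → V) → V) [IsTerm s] [IsTerm t] => hFd.isClass₂.dfn s t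
  obtain ⟨s, hs⟩ := hV.small_image (small_mem a) F hF
  obtain ⟨x, hx, -⟩ := hG' s
  obtain ⟨f, hf⟩ := hV.exists_pairMem (hV.small_or (small_mem a) (hV.small_singleton a))
    (hV.small_or (small_mem s) (hV.small_singleton x))
    (fun k y => F k y ∨ k = a ∧ y = x)
  -- Below `a`, the set `f` of pairs is the graph of `F`.
  have hfF : ∀ k y, r k a → (PairMem r f k y ↔ F k y) := by
    intro k y hk
    rw [hf]
    refine ⟨?_, fun h => ⟨.inl hk, .inl ((hs y).2 ⟨k, hk, h⟩), .inl h⟩⟩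
    rintro ⟨-, -, h | ⟨rfl, -⟩⟩
    · exact h
    · exact (ha.irrefl hV hk).elim
  refine ⟨x, f, fun k y hky => ?_, (hf a x).2 ⟨.inr rfl, .inr rfl, .inr ⟨rfl, rfl⟩⟩⟩
  rcases ((hf k y).1 hky).2.2 with ⟨hk, g, hg, hgy⟩ | ⟨rfl, rfl⟩
  · obtain ⟨hd, t, ht, hty⟩ := hg k y hgy
    have hja : ∀ j, r j k → r j a := ha.trans k hk
    refine ⟨fun j hj => ?_, t, fun z => ?_, hty⟩
    · obtain ⟨z, hz⟩ := hd j hj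
      exact ⟨z, (hfF j z (hja j hj)).2 ⟨hja j hj, g, hg, hz⟩⟩
    · rw [ht]
      refine exists_congr fun j => and_congr_right fun hj => ?_
      rw [hfF j z (hja j hj)]
      refine ⟨fun hz => ⟨hja j hj, g, hg, hz⟩, fun hz => ?_⟩
      obtain ⟨z', hz'⟩ := hd j hj
      rwa [hF j z z' hz ⟨hja j hj, g, hg, hz'⟩]
  · refine ⟨fun j hj => ?_, s, fun z => ?_, hx⟩
    · obtain ⟨z, g, hg⟩ := ih j hj
      exact ⟨z, (hfF j z hj).2 ⟨hj, g, hg⟩⟩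
    · rw [hs]
      exact exists_congr fun j => and_congr_right fun hj => (hfF j z hj).symm

/-- Recursion on the ordinals: a class function `G` on sets determines a class function `F` with
`F a = G {F b : b ∈ a}` for all ordinals `a`. Of the definability of `F` only its consequence is
kept, that images of sets of ordinals are sets. -/
theorem exists_ordinal_recursion : ∃ F : V → V,
    (∀ P, Small r P → (∀ a, P a → IsOrdinal r a) → Small r fun y => ∃ a, P a ∧ F a = y) ∧
    ∀ a, IsOrdinal r a → ∀ s, IsImage r F a s → G s (F a) := by
  have := fun (s t : (ℕ → V) → V) [IsTerm s] [IsTerm t] => hG.isClass₂.dfn s t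
  have hR : Dfn r fun v => IsRecursive r G (v 0) := by unfold IsRecursive; infer_instance
  have := fun (s : (ℕ → V) → V) [IsTerm s] => hR.isClass₁.dfn s
  choose! F hF using fun a (ha : IsOrdinal r a) => IsRecursive.exists hV hG' ha
  have huniq : ∀ a, IsOrdinal r a → ∀ f x, IsRecursive r G f → PairMem r f a x → F a = x := by
    intro a ha f x hf hx
    obtain ⟨g, hg, hgx⟩ := hF a ha
    exact IsRecursive.unique hV hG' ha g f _ x hg hf hgx hx
  refine ⟨F, fun P hP hPo => ?_, fun a ha s hs => ?_⟩
  · refine (hV.small_image hP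
      (fun a x => IsOrdinal r a ∧ ∃ f, IsRecursive r G f ∧ PairMem r f a x) ?_).congr
      fun y => exists_congr fun a => and_congr_right fun ha => ⟨?_, ?_⟩
    · rintro a x x' ⟨ha, f, hf, hx⟩ ⟨-, f', hf', hx'⟩
      exact IsRecursive.unique hV hG' ha f f' x x' hf hf' hx hx'
    · rintro rfl
      exact ⟨hPo a ha, hF a (hPo a ha)⟩
    · rintro ⟨ha, f, hf, hx⟩
      exact huniq a ha f y hf hx
  · obtain ⟨f, hf, hx⟩ := hF a ha
    obtain ⟨hd, t, ht, htx⟩ := hf a _ hx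
    have : s = t := hV.ext fun y => by
      rw [hs, ht]
      refine exists_congr fun j => and_congr_right fun hj => ⟨?_, fun hy => ?_⟩
      · rintro rfl
        obtain ⟨y, hy⟩ := hd j hj
        rwa [huniq j (ha.of_mem hV hj) f y hf hy]
      · exact huniq j (ha.of_mem hV hj) f y hf hy
    rwa [this]

end Recursion

/-- Every set is included in a transitive set. -/
theorem IsModelZFMinus.exists_isTrans (hV : IsModelZFMinus r) (x : V) :
    ∃ t, IsTrans r t ∧ ∀ z, r z x → r z t := by
  -- `F a = x ∪ ⋃ ⋃ {F b : b ∈ a}`, so that the union of `F n` for finite `n` is transitive.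
  obtain ⟨F, hsmall, hF⟩ := exists_ordinal_recursion hV
    (G := fun s y => ∀ z, r z y ↔ r z x ∨ ∃ u, (∃ w, r w s ∧ r u w) ∧ r z u) (fun s => by
      obtain ⟨y, hy⟩ := hV.small_or (small_mem x)
        (hV.small_sUnion (hV.small_sUnion (small_mem s)))
      exact ⟨y, hy, fun y' hy' => hV.ext fun z => (hy' z).trans (hy z).symm⟩)
  obtain ⟨a, ha, ⟨e, hea, he⟩, hsucc⟩ := hV.exists_inductive_ordinals
  have hF' : ∀ n, IsOrdinal r n → ∀ z,
      r z (F n) ↔ r z x ∨ ∃ u, (∃ j, r j n ∧ r u (F j)) ∧ r z u := by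
    intro n hn z
    obtain ⟨s, hs⟩ := hsmall (fun j => r j n) (small_mem n) fun j hj => hn.of_mem hV hj
    rw [hF n hn s hs]
    simp only [hs]
    grind
  obtain ⟨t, ht⟩ := hV.small_sUnion (hsmall _ (small_mem a) ha)
  refine ⟨t, fun u hu z hz => ?_, fun z hz => ?_⟩
  · obtain ⟨_, ⟨n, hn, rfl⟩, hun⟩ := (ht u).1 hu
    obtain ⟨m, hm, hnm⟩ := hsucc n hn
    exact (ht z).2 ⟨_, ⟨m, hm, rfl⟩,
      (hF' m (ha m hm) z).2 (.inr ⟨u, ⟨n, (hnm n).2 (.inr rfl), hun⟩, hz⟩)⟩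
  · exact (ht z).2 ⟨_, ⟨e, hea, rfl⟩, (hF' e (ha e hea) z).2 (.inl hz)⟩

/-! ### The levels of the iteration -/

section Levels

/-- `y` is a nonempty set which no element of `A` represents. -/
def Str.Fresh (r : V → V → Prop) (A : Str V) (y : V) : Prop :=
  (∃ u, r u y) ∧ ¬ ∃ v ∈ A.carrier, A.Represents r v y

/-- The set of pairs `f` certifies its elements `(x, a)`: the set `x` is unrepresented in `A`, and
for some `b ∈ a` each element of `x` belongs to `A` or is paired with `b` in `f`. -/
def Str.IsCertificate (r : V → V → Prop) (A : Str V) (f : V) : Prop :=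
  ∀ x a, PairMem r f x a →
    A.Fresh r x ∧ ∃ b, r b a ∧ ∀ z, r z x → z ∈ A.carrier ∨ PairMem r f z b

/-- `x` belongs to the `a`-th level over `A`. This is a first-order definition of the levels,
although they may be proper classes: membership in a level is witnessed by a set. -/
def Str.Level (r : V → V → Prop) (A : Str V) (a x : V) : Prop :=
  x ∈ A.carrier ∨ ∃ f, A.IsCertificate r f ∧ PairMem r f x a

/-- The `a`-th stage over `A`: an element of `A` keeps its predecessors, and the predecessors of
any other element are its elements. -/
def Str.stage (r : V → V → Prop) (A : Str V) (a : V) : Str V where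
  carrier := {x | A.Level r a x}
  rel := fun u v => A.rel u v ∨ A.Level r a v ∧ v ∉ A.carrier ∧ r u v

variable {A : Str V} (hA : A.IsClassStr r)
include hA

theorem Str.IsClassStr.dfn_carrier (s : (ℕ → V) → V) [IsTerm s] :
    Dfn r fun v => s v ∈ A.carrier := hA.carrier_class.dfn s

theorem Str.IsClassStr.dfn_rel (s t : (ℕ → V) → V) [IsTerm s] [IsTerm t] :
    Dfn r fun v => A.rel (s v) (t v) := hA.rel_class.dfn s t

theorem Str.IsClassStr.dfn_fresh (s : (ℕ → V) → V) [IsTerm s] :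
    Dfn r fun v => A.Fresh r (s v) := by
  have := fun (s : (ℕ → V) → V) [IsTerm s] => hA.dfn_carrier s
  have := fun (s t : (ℕ → V) → V) [IsTerm s] [IsTerm t] => hA.dfn_rel s t
  have h : Dfn r fun v => A.Fresh r (v 0) := by
    unfold Str.Fresh Str.Represents; infer_instance
  exact h.isClass₁.dfn s

theorem Str.IsClassStr.dfn_isCertificate (s : (ℕ → V) → V) [IsTerm s] :
    Dfn r fun v => A.IsCertificate r (s v) := by
  have := fun (s : (ℕ → V) → V) [IsTerm s] => hA.dfn_carrier s
  have := fun (s : (ℕ → V) → V) [IsTerm s] => hA.dfn_fresh s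
  have h : Dfn r fun v => A.IsCertificate r (v 0) := by
    unfold Str.IsCertificate; infer_instance
  exact h.isClass₁.dfn s

theorem Str.IsClassStr.dfn_level (s t : (ℕ → V) → V) [IsTerm s] [IsTerm t] :
    Dfn r fun v => A.Level r (s v) (t v) := by
  have := fun (s : (ℕ → V) → V) [IsTerm s] => hA.dfn_carrier s
  have := fun (s : (ℕ → V) → V) [IsTerm s] => hA.dfn_isCertificate s
  have h : Dfn r fun v => A.Level r (v 0) (v 1) := by
    unfold Str.Level; infer_instance
  exact h.isClass₂.dfn s t

variable (hV : IsModelZFMinus r)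
include hV

/-- The recursive description of the levels. Certificates for the elements of `x` need not be
chosen: on a transitive set including `x`, all certified pairs together form one certificate. -/
theorem Str.level_iff {a : V} (ha : IsOrdinal r a) (x : V) : A.Level r a x ↔
    x ∈ A.carrier ∨ A.Fresh r x ∧ ∃ b, r b a ∧ ∀ z, r z x → A.Level r b z := by
  refine or_congr_right' fun hxA => ⟨?_, ?_⟩
  · rintro ⟨f, hf, hx⟩
    obtain ⟨hfr, b, hb, h⟩ := hf x a hx
    exact ⟨hfr, b, hb, fun z hz => (h z hz).imp_right fun h => ⟨f, hf, h⟩⟩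
  · rintro ⟨hfr, b, hb, h⟩
    have := fun (s : (ℕ → V) → V) [IsTerm s] => hA.dfn_isCertificate s
    obtain ⟨t, ht, hxt⟩ := hV.exists_isTrans x
    obtain ⟨f, hf⟩ := hV.exists_pairMem (hV.small_or (small_mem t) (hV.small_singleton x))
      (hV.small_or (small_mem a) (hV.small_singleton a))
      (fun z b => r b a ∧ (∃ g, A.IsCertificate r g ∧ PairMem r g z b) ∨ z = x ∧ b = a)
    refine ⟨f, fun z c hzc => ?_, (hf x a).2 ⟨.inr rfl, .inr rfl, .inr ⟨rfl, rfl⟩⟩⟩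
    obtain ⟨hz, -, ⟨hc, g, hg, hgz⟩ | ⟨rfl, rfl⟩⟩ := (hf z c).1 hzc
    · obtain ⟨hfz, d, hd, hgd⟩ := hg z c hgz
      refine ⟨hfz, d, hd, fun w hw => (hgd w hw).imp_right fun hgw => ?_⟩
      have hda := ha.trans c hc d hd
      refine (hf w d).2 ⟨.inl ?_, .inl hda, .inl ⟨hda, g, hg, hgw⟩⟩
      rcases hz with hz | rfl
      · exact ht z hz w hw
      · exact hxt w hw
    · exact ⟨hfr, b, hb, fun w hw => (h w hw).imp_right fun hg =>
        (hf w b).2 ⟨.inl (hxt w hw), .inl hb, .inl ⟨hb, hg⟩⟩⟩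

theorem Str.Level.mono {a b : V} (ha : IsOrdinal r a) (hb : IsOrdinal r b)
    (hab : ∀ z, r z a → r z b) {x : V} (hx : A.Level r a x) : A.Level r b x := by
  rw [Str.level_iff hA hV ha] at hx
  rw [Str.level_iff hA hV hb]
  exact hx.imp_right fun ⟨h, c, hc, h'⟩ => ⟨h, c, hab c hc, h'⟩

/-- Every element of a level has an element of `A` in the transitive closure of its singleton. -/
theorem Str.Level.exists_inTC {a : V} (ha : IsOrdinal r a) :
    ∀ x, A.Level r a x → ∃ m ∈ A.carrier, m = x ∨ InTC r m x := by
  have := fun (s : (ℕ → V) → V) [IsTerm s] => hA.dfn_carrier s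
  have := fun (s t : (ℕ → V) → V) [IsTerm s] [IsTerm t] => hA.dfn_level s t
  refine IsOrdinal.induction hV
    (fun a => ∀ x, A.Level r a x → ∃ m ∈ A.carrier, m = x ∨ InTC r m x) ?_ a ha
  intro a ha ih x hx
  rcases (Str.level_iff hA hV ha x).1 hx with hx | ⟨⟨⟨z, hz⟩, -⟩, b, hb, h⟩
  · exact ⟨x, hx, .inl rfl⟩
  · obtain ⟨m, hm, rfl | h⟩ := ih b hb z (h z hz)
    · exact ⟨m, hm, .inr fun t _ hxt => hxt m hz⟩
    · exact ⟨m, hm, .inr fun t ht hxt => h t ht fun w hw => ht z (hxt z hz) w hw⟩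

variable (hii : ∀ x ∈ A.carrier, ∀ y ∈ A.carrier, ¬ InTC r x y)
include hii

/-- A nonempty set of elements of a level does not belong to `A`. -/
theorem Str.Level.not_mem_carrier {a y z : V} (ha : IsOrdinal r a) (hz : r z y)
    (hza : A.Level r a z) : y ∉ A.carrier := by
  intro hy
  obtain ⟨m, hm, rfl | h⟩ := Str.Level.exists_inTC hA hV ha z hza
  · exact hii m hm y hy fun t _ hyt => hyt m hz
  · exact hii m hm y hy fun t ht hyt => h t ht fun w hw => ht z (hyt z hz) w hw

end Levels

/-! ### The stages form the unique iteration -/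

section Stages

variable {A : Str V} (hA : A.IsClassStr r) (hV : IsModelZFMinus r)
include hA hV

theorem Str.Level.of_mem {a u v : V} (ha : IsOrdinal r a) (hv : A.Level r a v)
    (hvA : v ∉ A.carrier) (huv : r u v) : A.Level r a u := by
  obtain hv | ⟨-, b, hb, h⟩ := (Str.level_iff hA hV ha v).1 hv
  · exact (hvA hv).elim
  · exact (h u huv).mono hA hV (ha.of_mem hV hb) ha fun z hz => ha.trans b hb z hz

theorem Str.Level.fresh {a v : V} (ha : IsOrdinal r a) (hv : A.Level r a v)
    (hvA : v ∉ A.carrier) : A.Fresh r v :=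
  (((Str.level_iff hA hV ha v).1 hv).resolve_left hvA).1

theorem Str.level_empty {e : V} (he : ∀ z, ¬ r z e) (x : V) :
    A.Level r e x ↔ x ∈ A.carrier := by
  rw [Str.level_iff hA hV (IsOrdinal.of_empty hV he)]
  exact or_iff_left fun ⟨_, b, hb, _⟩ => he b hb

theorem Str.level_succ {a b : V} (ha : IsOrdinal r a) (hab : IsSucc r a b) (x : V) :
    A.Level r b x ↔ A.Level r a x ∨ A.Fresh r x ∧ ∀ z, r z x → A.Level r a z := by
  have hb := ha.of_isSucc hV hab
  have hab' : ∀ z, r z a → r z b := fun z hz => (hab z).2 (.inl hz)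
  rw [Str.level_iff hA hV hb]
  constructor
  · rintro (hx | ⟨hx, c, hc, h⟩)
    · exact .inl (.inl hx)
    · refine .inr ⟨hx, fun z hz => (h z hz).mono hA hV (hb.of_mem hV hc) ha ?_⟩
      rcases (hab c).1 hc with hc | rfl
      · exact ha.trans c hc
      · exact fun _ => id
  · rintro (hx | ⟨hx, h⟩)
    · exact (Str.level_iff hA hV hb x).1 (hx.mono hA hV ha hb hab')
    · exact .inr ⟨hx, a, (hab a).2 (.inr rfl), h⟩

theorem Str.level_limit {a : V} (ha : IsOrdinal r a) (hlim : IsLimitOrd r ⟨a, ha⟩) (x : V) :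
    A.Level r a x ↔ ∃ b, r b a ∧ A.Level r b x := by
  constructor
  · intro hx
    rcases (Str.level_iff hA hV ha x).1 hx with hx | ⟨hx, b, hb, h⟩
    · obtain ⟨b, hb⟩ := hlim.1
      exact ⟨b, hb, .inl hx⟩
    · obtain ⟨c, hc⟩ := hV.exists_isSucc b
      exact ⟨c, ha.succ_mem_of_mem_limit hV hlim hb hc,
        (Str.level_succ hA hV (ha.of_mem hV hb) hc x).2 (.inr ⟨hx, h⟩)⟩
  · rintro ⟨b, hb, hx⟩
    exact hx.mono hA hV (ha.of_mem hV hb) ha (ha.trans b hb)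

variable (hii : ∀ x ∈ A.carrier, ∀ y ∈ A.carrier, ¬ InTC r x y)
include hii

/-- The sets which are unrepresented in a stage: an element of the stage outside `A` represents
exactly itself. -/
theorem Str.mem_unrep_stage {a : V} (ha : IsOrdinal r a) (y : V) :
    y ∈ (A.stage r a).unrep r ↔
      A.Fresh r y ∧ (∀ u, r u y → A.Level r a u) ∧ ¬ A.Level r a y := by
  constructor
  · rintro ⟨⟨z, hz⟩, hsub, hno⟩
    have hyA := Str.Level.not_mem_carrier hA hV hii ha hz (hsub z hz)
    refine ⟨⟨⟨z, hz⟩, ?_⟩, hsub, fun hy => hno ⟨y, hy, fun u => ?_⟩⟩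
    · rintro ⟨v, hv, hvy⟩
      refine hno ⟨v, .inl hv, fun u => ⟨fun hu => ?_, ?_⟩⟩
      · exact ⟨hsub u hu, .inl ((hvy u).1 hu).2⟩
      · rintro ⟨-, hu | ⟨-, hu, -⟩⟩
        · exact (hvy u).2 ⟨(hA.rel_sub u v hu).1, hu⟩
        · exact (hu hv).elim
    · refine ⟨fun hu => ⟨hsub u hu, .inr ⟨hy, hyA, hu⟩⟩, ?_⟩
      rintro ⟨-, hu | ⟨-, -, hu⟩⟩
      · exact (hyA (hA.rel_sub u y hu).2).elim
      · exact hu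
  · rintro ⟨⟨hne, hfr⟩, hsub, hy⟩
    refine ⟨hne, hsub, ?_⟩
    rintro ⟨v, hv, hvy⟩
    by_cases hvA : v ∈ A.carrier
    · refine hfr ⟨v, hvA, fun u => (hvy u).trans ⟨?_, fun hu => ⟨.inl hu.1, .inl hu.2⟩⟩⟩
      rintro ⟨-, hu | ⟨-, hu, -⟩⟩
      · exact ⟨(hA.rel_sub u v hu).1, hu⟩
      · exact (hu hvA).elim
    · have : y = v := hV.ext fun u => (hvy u).trans ⟨?_, fun hu =>
        ⟨Str.Level.of_mem hA hV ha hv hvA hu, .inr ⟨hv, hvA, hu⟩⟩⟩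
      · exact hy (this ▸ hv)
      · rintro ⟨-, hu | ⟨-, -, hu⟩⟩
        · exact (hvA (hA.rel_sub u v hu).2).elim
        · exact hu

theorem Str.stage_succ {a b : V} (ha : IsOrdinal r a) (hab : IsSucc r a b) :
    A.stage r b = (A.stage r a).next r := by
  have hlevel : ∀ y, A.Level r b y ↔ A.Level r a y ∨ y ∈ (A.stage r a).unrep r := by
    intro y
    rw [Str.level_succ hA hV ha hab, Str.mem_unrep_stage hA hV hii ha]
    tauto
  refine Str.ext (Set.ext hlevel) (funext fun u => funext fun v => propext ?_)
  change (_ ∨ _) ↔ (_ ∨ _) ∨ (A.Level r a u ∧ _)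
  rw [hlevel]
  constructor
  · rintro (h | ⟨h | h, hvA, huv⟩)
    · exact .inl (.inl h)
    · exact .inl (.inr ⟨h, hvA, huv⟩)
    · exact .inr ⟨h.2.1 u huv, h, huv⟩
  · rintro ((h | ⟨h, hvA, huv⟩) | ⟨hu, hv, huv⟩)
    · exact .inl h
    · exact .inr ⟨.inl h, hvA, huv⟩
    · exact .inr ⟨.inr hv, Str.Level.not_mem_carrier hA hV hii ha huv hu, huv⟩

theorem isIteration_stage : IsIteration r A fun a => A.stage r a.1 where
  carrier_class := by
    have := fun (s t : (ℕ → V) → V) [IsTerm s] [IsTerm t] => hA.dfn_level s t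
    exact Dfn.isClass₂ ((inferInstance : Dfn r fun v => IsOrdinal r (v 0) ∧
      A.Level r (v 0) (v 1)).congr fun v => ⟨fun ⟨h, h'⟩ => ⟨h, h'⟩, fun ⟨h, h'⟩ => ⟨h, h'⟩⟩)
  rel_class := by
    have := fun (s : (ℕ → V) → V) [IsTerm s] => hA.dfn_carrier s
    have := fun (s t : (ℕ → V) → V) [IsTerm s] [IsTerm t] => hA.dfn_rel s t
    have := fun (s t : (ℕ → V) → V) [IsTerm s] [IsTerm t] => hA.dfn_level s t
    exact Dfn.isClass₃ ((inferInstance : Dfn r fun v => IsOrdinal r (v 0) ∧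
      (A.rel (v 1) (v 2) ∨ A.Level r (v 0) (v 2) ∧ v 2 ∉ A.carrier ∧ r (v 1) (v 2))).congr
      fun v => ⟨fun ⟨h, h'⟩ => ⟨h, h'⟩, fun ⟨h, h'⟩ => ⟨h, h'⟩⟩)
  zero a he := by
    refine Str.ext (Set.ext (Str.level_empty hA hV he)) (funext fun u => funext fun v => propext ?_)
    refine or_iff_left ?_
    rw [Str.level_empty hA hV he]
    tauto
  succ a b hab := Str.stage_succ hA hV hii a.2 hab
  limit a hlim := by
    have hlevel := Str.level_limit hA hV a.2 hlim
    refine Str.ext (Set.ext fun x => ?_) (funext fun u => funext fun v => propext ?_)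
    · refine (hlevel x).trans ⟨?_, ?_⟩
      · rintro ⟨b, hb, h⟩
        exact ⟨⟨b, a.2.of_mem hV hb⟩, hb, h⟩
      · rintro ⟨b, hb, h⟩
        exact ⟨b, hb, h⟩
    · constructor
      · rintro (h | ⟨h, h'⟩)
        · obtain ⟨b, hb⟩ := hlim.1
          exact ⟨⟨b, a.2.of_mem hV hb⟩, hb, .inl h⟩
        · obtain ⟨b, hb, h⟩ := (hlevel v).1 h
          exact ⟨⟨b, a.2.of_mem hV hb⟩, hb, .inr ⟨h, h'⟩⟩
      · rintro ⟨b, hb, h | ⟨h, h'⟩⟩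
        · exact .inl h
        · exact .inr ⟨(hlevel v).2 ⟨b, hb, h⟩, h'⟩

end Stages

/-- Two iterations agree, by induction on the ordinals: both being class families, the ordinals at
which they agree form a class. -/
theorem IsIteration.unique (hV : IsModelZFMinus r) {A : Str V} {H H' : OrdinalOf r → Str V}
    (hH : IsIteration r A H) (hH' : IsIteration r A H') : H = H' := by
  let C (H : OrdinalOf r → Str V) (a x : V) : Prop := ∃ h : IsOrdinal r a, x ∈ (H ⟨a, h⟩).carrier
  let R (H : OrdinalOf r → Str V) (a x y : V) : Prop := ∃ h : IsOrdinal r a, (H ⟨a, h⟩).rel x y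
  have := fun (s t : (ℕ → V) → V) [IsTerm s] [IsTerm t] =>
    (hH.carrier_class.dfn s t : Dfn r fun v => C H (s v) (t v))
  have := fun (s t : (ℕ → V) → V) [IsTerm s] [IsTerm t] =>
    (hH'.carrier_class.dfn s t : Dfn r fun v => C H' (s v) (t v))
  have := fun (s t w : (ℕ → V) → V) [IsTerm s] [IsTerm t] [IsTerm w] =>
    (hH.rel_class.dfn s t w : Dfn r fun v => R H (s v) (t v) (w v))
  have := fun (s t w : (ℕ → V) → V) [IsTerm s] [IsTerm t] [IsTerm w] =>
    (hH'.rel_class.dfn s t w : Dfn r fun v => R H' (s v) (t v) (w v))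
  -- Equality of the two stages at `a`, as a class of ordinals `a`.
  have key : ∀ (a) (ha : IsOrdinal r a), H ⟨a, ha⟩ = H' ⟨a, ha⟩ ↔
      (∀ x, C H a x ↔ C H' a x) ∧ ∀ x y, R H a x y ↔ R H' a x y := by
    intro a ha
    simp only [C, R, ha, exists_true_left, Str.ext_iff, Set.ext_iff, funext_iff, eq_iff_iff]
  have all : ∀ a, IsOrdinal r a →
      (∀ x, C H a x ↔ C H' a x) ∧ ∀ x y, R H a x y ↔ R H' a x y := by
    refine IsOrdinal.induction hV
      (fun a => (∀ x, C H a x ↔ C H' a x) ∧ ∀ x y, R H a x y ↔ R H' a x y) ?_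
    intro a ha ih
    have ih' : ∀ b : OrdinalOf r, r b.1 a → H b = H' b := fun b hb => (key b.1 b.2).2 (ih b.1 hb)
    rw [← key a ha]
    by_cases hzero : ∀ x, ¬ r x a
    · rw [hH.zero ⟨a, ha⟩ hzero, hH'.zero ⟨a, ha⟩ hzero]
    by_cases hsucc : ∃ b : OrdinalOf r, IsSucc r b.1 a
    · obtain ⟨b, hb⟩ := hsucc
      rw [hH.succ b ⟨a, ha⟩ hb, hH'.succ b ⟨a, ha⟩ hb, ih' b ((hb _).2 (.inr rfl))]
    · have hlim : IsLimitOrd r ⟨a, ha⟩ := ⟨by simpa using hzero, by simpa using hsucc⟩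
      rw [hH.limit _ hlim, hH'.limit _ hlim]
      refine Str.ext (Set.ext fun x => exists_congr fun b => and_congr_right fun hb => ?_)
        (funext fun x => funext fun y => propext <|
          exists_congr fun b => and_congr_right fun hb => ?_)
      · rw [ih' b hb]
      · rw [ih' b hb]
  exact funext fun a => (key a.1 a.2).2 (all a.1 a.2)

/-! ### Structures in which every set is represented -/

/-- A class structure which is extensional and in which the sets of elements of the structure are
exactly the extents `{u : u E v}` of its elements `v`. -/
structure Str.IsFull (r : V → V → Prop) (B : Str V) : Prop where
  classStr : B.IsClassStr r
  small_rel : ∀ v ∈ B.carrier, Small r fun u => B.rel u v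
  exists_represents : ∀ y, (∀ u, r u y → u ∈ B.carrier) → ∃ v ∈ B.carrier, B.Represents r v y
  extensionality : Extensionality B.on

section Full

variable {B : Str V} (hB : B.IsFull r)
include hB

theorem Str.IsFull.exists_on {P : V → Prop} (hP : Small r P) (hPB : ∀ u, P u → u ∈ B.carrier) :
    ∃ v : B.carrier, ∀ u : B.carrier, B.on u v ↔ P u := by
  obtain ⟨y, hy⟩ := hP
  obtain ⟨v, hv, hvy⟩ := hB.exists_represents y fun u hu => hPB u ((hy u).1 hu)
  exact ⟨⟨v, hv⟩, fun u => by rw [← hy, hvy]; exact (and_iff_right u.2).symm⟩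

variable (hV : IsModelZFMinus r)
include hV

/-- A retraction of `V` onto the carrier of a class structure pulls classes back to classes. -/
theorem Str.IsFull.exists_retraction : ∃ c : V → B.carrier, (∀ x : B.carrier, c x = x) ∧
    (∀ P, IsClass₁ B.on P → IsClass₁ r fun x => P (c x)) ∧
    ∀ F, IsClass₂ B.on F → IsClass₂ r fun x y => F (c x) (c y) := by
  classical
  obtain ⟨e, he⟩ := hV.exists_empty
  obtain ⟨m, hm, -⟩ := hB.exists_represents e fun u hu => (he u hu).elim
  let c : V → B.carrier := fun x => if h : x ∈ B.carrier then ⟨x, h⟩ else ⟨m, hm⟩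
  have hcx : ∀ x : B.carrier, c x = x := fun x => dif_pos x.2
  have hsurj : Function.Surjective c := fun x => ⟨x, hcx x⟩
  have hc : ∀ x z, (c x : V) = z ↔ x ∈ B.carrier ∧ x = z ∨ x ∉ B.carrier ∧ m = z := by
    intro x z
    by_cases h : x ∈ B.carrier <;> simp [c, h]
  have := fun (s : (ℕ → V) → V) [IsTerm s] => hB.classStr.dfn_carrier s
  have := fun (s t : (ℕ → V) → V) [IsTerm s] [IsTerm t] => hB.classStr.dfn_rel s t
  have hE : IsClass₂ r fun x y => B.on (c x) (c y) := by
    refine Dfn.isClass₂ ((inferInstance : Dfn r fun v => ∃ z w,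
      (v 0 ∈ B.carrier ∧ v 0 = z ∨ v 0 ∉ B.carrier ∧ m = z) ∧
      (v 1 ∈ B.carrier ∧ v 1 = w ∨ v 1 ∉ B.carrier ∧ m = w) ∧ B.rel z w).congr fun v => ?_)
    simp only [← hc]
    simp [Str.on]
  have heq : IsClass₂ r fun x y => c x = c y := by
    refine Dfn.isClass₂ ((inferInstance : Dfn r fun v => ∃ z,
      (v 0 ∈ B.carrier ∧ v 0 = z ∨ v 0 ∉ B.carrier ∧ m = z) ∧
      (v 1 ∈ B.carrier ∧ v 1 = z ∨ v 1 ∉ B.carrier ∧ m = z)).congr fun v => ?_)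
    simp only [← hc]
    simp [Subtype.ext_iff, eq_comm]
  exact ⟨c, hcx, fun P hP => (IsDefinable.interpret hsurj hE heq hP).isClass₁,
    fun F hF => (IsDefinable.interpret hsurj hE heq hF).isClass₂⟩

/-- In a full structure the images of the ordinals of `V`, each representing the set of the images
of its elements, provide an inductive set. -/
theorem Str.IsFull.infinity : ∃ a, (∃ e, B.on e a ∧ ∀ z, ¬ B.on z e) ∧
    ∀ x, B.on x a → ∃ y, B.on y a ∧ IsSucc B.on x y := by
  have := fun (s : (ℕ → V) → V) [IsTerm s] => hB.classStr.dfn_carrier s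
  have := fun (s t : (ℕ → V) → V) [IsTerm s] [IsTerm t] => hB.classStr.dfn_rel s t
  -- Every `F a` represents `{F b : b ∈ a}`.
  obtain ⟨F, hsmall, hF⟩ := exists_ordinal_recursion hV
    (G := fun s x => x ∈ B.carrier ∧ ∀ u, B.rel u x ↔ r u s ∧ u ∈ B.carrier) (fun s => by
      obtain ⟨v, hv⟩ := hB.exists_on (P := fun u => r u s ∧ u ∈ B.carrier)
        (hV.small_subset (small_mem s) _ fun _ => And.left) fun _ => And.right
      refine ⟨v, ⟨v.2, fun u => ⟨fun hu => ?_, fun hu => (hv ⟨u, hu.2⟩).2 hu⟩⟩, ?_⟩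
      · exact (hv ⟨u, (hB.classStr.rel_sub u v hu).1⟩).1 hu
      · rintro w ⟨hw, hw'⟩
        exact congrArg Subtype.val (hB.extensionality ⟨w, hw⟩ v fun z => (hw' z).trans (hv z).symm))
  have hF' : ∀ n, IsOrdinal r n → F n ∈ B.carrier ∧
      ∀ u, B.rel u (F n) ↔ (∃ j, r j n ∧ F j = u) ∧ u ∈ B.carrier := by
    intro n hn
    obtain ⟨s, hs⟩ := hsmall (fun j => r j n) (small_mem n) fun j hj => hn.of_mem hV hj
    have h := hF n hn s hs
    exact ⟨h.1, fun u => by rw [h.2, hs]⟩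
  obtain ⟨a, ha, ⟨e, hea, he⟩, hsucc⟩ := hV.exists_inductive_ordinals
  obtain ⟨b, hb⟩ := hB.exists_on (hsmall _ (small_mem a) ha) (by
    rintro _ ⟨n, hn, rfl⟩
    exact (hF' n (ha n hn)).1)
  refine ⟨b, ⟨⟨F e, (hF' e (ha e hea)).1⟩, (hb _).2 ⟨e, hea, rfl⟩, fun z hz => ?_⟩, ?_⟩
  · obtain ⟨⟨j, hj, -⟩, -⟩ := ((hF' e (ha e hea)).2 z).1 hz
    exact he j hj
  · rintro ⟨x, hx⟩ hxb
    obtain ⟨n, hn, rfl⟩ := (hb _).1 hxb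
    obtain ⟨k, hk, hnk⟩ := hsucc n hn
    refine ⟨⟨F k, (hF' k (ha k hk)).1⟩, (hb _).2 ⟨k, hk, rfl⟩, fun z => ?_⟩
    refine ((hF' k (ha k hk)).2 z).trans (Iff.trans ?_
      (or_congr_left ((hF' n (ha n hn)).2 z).symm))
    simp only [z.2, and_true, hnk _, Subtype.ext_iff]
    grind

/-- A full structure inherits the axioms: each asserts that some class is a set, and a class of
elements of the structure which is a set of `V` is represented. -/
theorem Str.IsFull.isModelZFMinus : IsModelZFMinus B.on := by
  have hdc := fun (s : (ℕ → V) → V) [IsTerm s] => hB.classStr.dfn_carrier s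
  have hdr := fun (s t : (ℕ → V) → V) [IsTerm s] [IsTerm t] => hB.classStr.dfn_rel s t
  have hsub := hB.classStr.rel_sub
  obtain ⟨c, hcx, hc₁, hc₂⟩ := hB.exists_retraction hV
  refine ⟨hB.extensionality, fun x y => ?_, fun a => ?_, fun a => ?_, hB.infinity hV,
    fun P hP a => ?_, fun F hF hfun a => ?_⟩
  · obtain ⟨v, hv⟩ := hB.exists_on (hV.small_pair x.1 y.1) (by
      rintro u (rfl | rfl)
      · exact x.2
      · exact y.2)
    exact ⟨v, fun z => by rw [hv, Subtype.ext_iff, Subtype.ext_iff]⟩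
  · obtain ⟨v, hv⟩ := hB.exists_on (hV.small_biUnion (hB.small_rel a a.2)
      (fun x z => B.rel z x) fun x hx => hB.small_rel x (hsub x a hx).1) (by
        rintro u ⟨x, -, hu⟩
        exact (hsub u x hu).1)
    refine ⟨v, fun z => (hv z).trans ⟨?_, ?_⟩⟩
    · rintro ⟨x, hx, hz⟩
      exact ⟨⟨x, (hsub x a hx).1⟩, hx, hz⟩
    · rintro ⟨x, hx, hz⟩
      exact ⟨x, hx, hz⟩
  · obtain ⟨v, hv⟩ := hB.exists_on
      (hV.small_image (hV.small_powerSet (hB.small_rel a a.2))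
        (fun y x => x ∈ B.carrier ∧ ∀ u, B.rel u x ↔ r u y)
        fun y x x' hx hx' => congrArg Subtype.val (hB.extensionality ⟨x, hx.1⟩ ⟨x', hx'.1⟩ fun z =>
          (hx.2 z).trans (hx'.2 z).symm)) (by
      rintro u ⟨_, -, hu, -⟩
      exact hu)
    refine ⟨v, fun x => (hv x).trans ⟨?_, fun h => ?_⟩⟩
    · rintro ⟨y, hy, -, hyx⟩ z hz
      exact hy z ((hyx z).1 hz)
    · obtain ⟨y, hy⟩ := hB.small_rel x x.2
      exact ⟨y, fun z hz => h ⟨z, (hsub z x ((hy z).1 hz)).1⟩ ((hy z).1 hz), x.2,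
        fun u => (hy u).symm⟩
  · have := fun (s : (ℕ → V) → V) [IsTerm s] => (hc₁ P hP).dfn s
    obtain ⟨v, hv⟩ := hB.exists_on (hV.small_subset (hB.small_rel a a.2)
      (fun z => B.rel z a ∧ P (c z)) fun _ => And.left) fun u hu => (hsub u a hu.1).1
    exact ⟨v, fun z => by rw [hv, hcx]; rfl⟩
  · have := fun (s t : (ℕ → V) → V) [IsTerm s] [IsTerm t] => (hc₂ F hF).dfn s t
    obtain ⟨v, hv⟩ := hB.exists_on (hV.small_image (hB.small_rel a a.2)
      (fun x y => y ∈ B.carrier ∧ F (c x) (c y)) fun x y y' h h' => by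
        have h2 := hfun _ _ _ h.2 h'.2
        rw [hcx ⟨y, h.1⟩, hcx ⟨y', h'.1⟩] at h2
        exact congrArg Subtype.val h2) (by
      rintro u ⟨_, -, hu, -⟩
      exact hu)
    refine ⟨v, fun y => (hv y).trans ⟨?_, ?_⟩⟩
    · rintro ⟨x, hx, -, hF⟩
      have hxB := (hsub x a hx).1
      rw [hcx y, hcx ⟨x, hxB⟩] at hF
      exact ⟨⟨x, hxB⟩, hx, hF⟩
    · rintro ⟨x, hx, hF⟩
      exact ⟨x, hx, y.2, by rwa [hcx, hcx]⟩

theorem Str.IsFull.choice (hchoice : Choice r) : Choice B.on := by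
  have hdc := fun (s : (ℕ → V) → V) [IsTerm s] => hB.classStr.dfn_carrier s
  have hdr := fun (s t : (ℕ → V) → V) [IsTerm s] [IsTerm t] => hB.classStr.dfn_rel s t
  have hsub := hB.classStr.rel_sub
  intro a hne hdisj
  obtain ⟨s, hs⟩ := hV.small_image (hB.small_rel a a.2) (fun x y => ∀ u, r u y ↔ B.rel u x)
    fun x y y' h h' => hV.ext fun u => (h u).trans (h' u).symm
  obtain ⟨d, hd⟩ := hchoice s (fun y hy => by
      obtain ⟨x, hx, hxy⟩ := (hs y).1 hy
      obtain ⟨z, hz⟩ := hne ⟨x, (hsub x a hx).1⟩ hx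
      exact ⟨z, (hxy z).2 hz⟩) (fun y y' hy hy' hyy' z hz => by
      obtain ⟨x, hx, hxy⟩ := (hs y).1 hy
      obtain ⟨x', hx', hxy'⟩ := (hs y').1 hy'
      have hzx := (hxy z).1 hz.1
      refine hdisj ⟨x, (hsub x a hx).1⟩ ⟨x', (hsub x' a hx').1⟩ hx hx' (fun h => hyy' ?_)
        ⟨z, (hsub z x hzx).1⟩ ⟨hzx, (hxy' z).1 hz.2⟩
      obtain rfl : x = x' := congrArg Subtype.val h
      exact hV.ext fun u => (hxy u).trans (hxy' u).symm)
  obtain ⟨v, hv⟩ := hB.exists_on (hV.small_subset (small_mem d)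
    (fun z => r z d ∧ z ∈ B.carrier) fun _ => And.left) fun _ => And.right
  refine ⟨v, fun x hx => ?_⟩
  obtain ⟨y, hy⟩ := hB.small_rel x x.2
  obtain ⟨z, ⟨hzy, hzd⟩, hz⟩ := hd y ((hs y).2 ⟨x, hx, hy⟩)
  have hzx := (hy z).1 hzy
  have hzB := (hsub z x hzx).1
  refine ⟨⟨z, hzB⟩, ⟨hzx, (hv _).2 ⟨hzd, hzB⟩⟩, fun w hw => Subtype.ext ?_⟩
  exact hz w ⟨(hy w).2 hw.1, ((hv w).1 hw.2).1⟩

end Full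

/-! ### The union of the stages -/

/-- Every set `y` of elements of the union is represented there: if `A` has no representative of
`y` and `y` is not empty, then `y` enters at a stage above all its elements, as its own
representative. -/
theorem isFull_unionStr_stage (hV : IsModelZFMinus r) {A : Str V} (hA : A.IsClassStr r)
    (hi : ∀ v ∈ A.carrier, ∃ s : V, ∀ u, r u s ↔ A.rel u v)
    (hii : ∀ x ∈ A.carrier, ∀ y ∈ A.carrier, ¬ InTC r x y)
    (hiii : EmptySet A.on) (hiv : Extensionality A.on) :
    (unionStr r fun a => A.stage r a.1).IsFull r := by
  have := fun (s : (ℕ → V) → V) [IsTerm s] => hA.dfn_carrier s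
  have := fun (s t : (ℕ → V) → V) [IsTerm s] [IsTerm t] => hA.dfn_rel s t
  have := fun (s t : (ℕ → V) → V) [IsTerm s] [IsTerm t] => hA.dfn_level s t
  set B := unionStr r fun a => A.stage r a.1 with hB
  obtain ⟨e, he⟩ := hV.exists_empty
  have hcar : ∀ x, x ∈ B.carrier ↔ ∃ a, IsOrdinal r a ∧ A.Level r a x := fun x =>
    ⟨fun ⟨a, h⟩ => ⟨a.1, a.2, h⟩, fun ⟨a, ha, h⟩ => ⟨⟨a, ha⟩, h⟩⟩
  have hAB : ∀ x ∈ A.carrier, x ∈ B.carrier := fun x hx =>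
    (hcar x).2 ⟨e, IsOrdinal.of_empty hV he, .inl hx⟩
  have hrel : ∀ x y, B.rel x y ↔ A.rel x y ∨ y ∈ B.carrier ∧ y ∉ A.carrier ∧ r x y := by
    intro x y
    constructor
    · rintro ⟨a, h | ⟨h, h'⟩⟩
      · exact .inl h
      · exact .inr ⟨⟨a, h⟩, h'⟩
    · rintro (h | ⟨⟨a, h⟩, h'⟩)
      · exact ⟨⟨e, IsOrdinal.of_empty hV he⟩, .inl h⟩
      · exact ⟨a, .inr ⟨h, h'⟩⟩
  have hrelA : ∀ x, ∀ y ∈ A.carrier, (B.rel x y ↔ A.rel x y) := fun x y hy => by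
    simp [hrel, hy]
  have hrelB : ∀ x, ∀ y ∈ B.carrier, y ∉ A.carrier → (B.rel x y ↔ r x y) := fun x y hy hyA => by
    have : ¬ A.rel x y := fun h => hyA (hA.rel_sub x y h).2
    simp [hrel, hy, hyA, this]
  have hmem : ∀ x, ∀ y ∈ B.carrier, y ∉ A.carrier → r x y → x ∈ B.carrier := by
    intro x y hy hyA hxy
    obtain ⟨a, ha, h⟩ := (hcar y).1 hy
    exact (hcar x).2 ⟨a, ha, Str.Level.of_mem hA hV ha h hyA hxy⟩
  have hfresh : ∀ y ∈ B.carrier, y ∉ A.carrier → A.Fresh r y := by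
    intro y hy hyA
    obtain ⟨a, ha, h⟩ := (hcar y).1 hy
    exact h.fresh hA hV ha hyA
  -- An element of `A` and an element outside `A` have different extents.
  have hne : ∀ x y, x ∈ A.carrier → y ∈ B.carrier → y ∉ A.carrier →
      ¬ ∀ z ∈ B.carrier, (B.rel z x ↔ B.rel z y) := by
    intro x y hx hy hyA h
    refine (hfresh y hy hyA).2 ⟨x, hx, fun u => ⟨fun hu => ?_, fun hu => ?_⟩⟩
    · have h' := (hrelA u x hx).1 ((h u (hmem u y hy hyA hu)).2 ((hrelB u y hy hyA).2 hu))
      exact ⟨(hA.rel_sub u x h').1, h'⟩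
    · exact (hrelB u y hy hyA).1 ((h u (hAB u hu.1)).1 ((hrelA u x hx).2 hu.2))
  refine ⟨⟨?_, ?_, ?_⟩, ?_, ?_, ?_⟩
  · exact Dfn.isClass₁ ((inferInstance : Dfn r fun v => ∃ a, IsOrdinal r a ∧
      A.Level r a (v 0)).congr fun v => hcar (v 0))
  · refine Dfn.isClass₂ ((inferInstance : Dfn r fun v => A.rel (v 0) (v 1) ∨
      (∃ a, IsOrdinal r a ∧ A.Level r a (v 1)) ∧ v 1 ∉ A.carrier ∧ r (v 0) (v 1)).congr fun v => ?_)
    rw [hrel, hcar]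
  · intro x y h
    rcases (hrel x y).1 h with h | ⟨hy, hyA, hxy⟩
    · exact ⟨hAB x (hA.rel_sub x y h).1, hAB y (hA.rel_sub x y h).2⟩
    · exact ⟨hmem x y hy hyA hxy, hy⟩
  · intro v hv
    by_cases hvA : v ∈ A.carrier
    · exact Small.congr (hi v hvA) fun u => hrelA u v hvA
    · exact (small_mem v).congr fun u => hrelB u v hv hvA
  · intro y hy
    by_cases hempty : ∀ u, ¬ r u y
    · obtain ⟨m, hm⟩ := hiii
      refine ⟨m, hAB m m.2, fun u => iff_of_false (hempty u) fun hu => ?_⟩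
      have h := (hrelA u m m.2).1 hu.2
      exact hm ⟨u, (hA.rel_sub u m h).1⟩ h
    by_cases hrep : ∃ v ∈ A.carrier, A.Represents r v y
    · obtain ⟨v, hv, h⟩ := hrep
      refine ⟨v, hAB v hv, fun u => (h u).trans ?_⟩
      rw [hrelA u v hv]
      exact ⟨fun h => ⟨hAB u h.1, h.2⟩, fun h => ⟨(hA.rel_sub u v h.2).1, h.2⟩⟩
    -- Replacement bounds the least levels of the elements of `y`.
    have hsm := hV.small_image (small_mem y)
      (fun z a => IsOrdinal r a ∧ A.Level r a z ∧ ∀ b, r b a → ¬ A.Level r b z) (by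
        rintro z a a' ⟨ha, h1, h2⟩ ⟨ha', h1', h2'⟩
        rcases ha.comparable hV a' ha' with h | h | h
        · exact (h2' a h h1).elim
        · exact h
        · exact (h2 a' h h1').elim)
    obtain ⟨b, hb, hbound⟩ := IsOrdinal.exists_bound hV hsm (by
      rintro a ⟨_, -, ha, -⟩
      exact ha)
    have hyb : ∀ z, r z y → A.Level r b z := by
      intro z hz
      obtain ⟨a, ha, h⟩ := (hcar z).1 (hy z hz)
      obtain ⟨m, hm, h1, h2⟩ := IsOrdinal.exists_least hV (fun a => A.Level r a z) ha h
      exact h1.mono hA hV hm hb (hbound m ⟨z, hz, hm, h1, h2⟩)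
    obtain ⟨d, hbd⟩ := hV.exists_isSucc b
    have hyB : y ∈ B.carrier := (hcar y).2 ⟨d, hb.of_isSucc hV hbd,
      (Str.level_succ hA hV hb hbd y).2 (.inr ⟨⟨by simpa using hempty, hrep⟩, hyb⟩)⟩
    obtain ⟨z, hz⟩ := not_forall_not.1 hempty
    have hyA := Str.Level.not_mem_carrier hA hV hii hb hz (hyb z hz)
    refine ⟨y, hyB, fun u => ?_⟩
    rw [hrelB u y hyB hyA]
    exact ⟨fun hu => ⟨hy u hu, hu⟩, And.right⟩
  · rintro ⟨x, hx⟩ ⟨y, hy⟩ h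
    have h : ∀ z ∈ B.carrier, (B.rel z x ↔ B.rel z y) := fun z hz => h ⟨z, hz⟩
    refine Subtype.ext ?_
    by_cases hxA : x ∈ A.carrier <;> by_cases hyA : y ∈ A.carrier
    · exact Subtype.mk.inj (hiv ⟨x, hxA⟩ ⟨y, hyA⟩ fun z =>
        ((hrelA z x hxA).symm.trans (h z (hAB z z.2))).trans (hrelA z y hyA))
    · exact (hne x y hxA hy hyA h).elim
    · exact (hne y x hyA hx hxA fun z hz => (h z hz).symm).elim
    · refine hV.ext fun z => ⟨fun hz => ?_, fun hz => ?_⟩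
      · exact (hrelB z y hy hyA).1 ((h z (hmem z x hx hxA hz)).1 ((hrelB z x hx hxA).2 hz))
      · exact (hrelB z x hx hxA).1 ((h z (hmem z y hy hyA hz)).2 ((hrelB z y hy hyA).2 hz))

end ClassModel

open ClassModel
theorem theorem3 {V : Type*} (r : V → V → Prop) (hV : IsModelZFMinus r)
    (A : Str V) (hA : A.IsClassStr r)
    (hi : ∀ v ∈ A.carrier, ∃ s : V, ∀ u, r u s ↔ A.rel u v)
    (hii : ∀ x ∈ A.carrier, ∀ y ∈ A.carrier, ¬ InTC r x y)
    (hiii : EmptySet A.on)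
    (hiv : Extensionality A.on) :
    (∃! H : OrdinalOf r → Str V, IsIteration r A H) ∧
      ∀ H : OrdinalOf r → Str V, IsIteration r A H →
        IsModelZFMinus (unionStr r H).on ∧
        (IsModelZFCMinus r → IsModelZFCMinus (unionStr r H).on) := by
  have hstage := isIteration_stage hA hV hii
  refine ⟨⟨_, hstage, fun H hH => hH.unique hV hstage⟩, fun H hH => ?_⟩
  obtain rfl := hH.unique hV hstage
  have hfull := isFull_unionStr_stage hV hA hi hii hiii hiv
  have hzf := hfull.isModelZFMinus hV
  exact ⟨hzf, fun h => ⟨hzf, hfull.choice hV h.choice⟩⟩
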